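/- Let $r\ge 1$ be an integer and $n=2^{4r}-1$. Let $\alpha$ be a primitive element of $\mathbb F_{2^{4r}}$, and let $\beta$ and $\gamma$ be, respectively, a primitive fifth and a primitive third root of unity in $\mathbb F_{2^{4r}}$. Put $$U=\{(1,1),(\alpha,\alpha),(\alpha,\alpha^{-1}),(\alpha,1),(\alpha^3,1),(1,\alpha),(1,\alpha^3),(1,\gamma),(\beta,\beta^2),(\alpha,\alpha^2),(\alpha^3,\alpha^{-3})\},$$ and let $C_U\subset\mathbb F_2^{n\times n}$ be the two-dimensional cyclic code consisting of all arrays $[a_{i,j}]_{0\le i,j\le n-1}$ whose polynomial $\sum_{i,j}a_{i,j}x^iy^j\in\mathbb F_2[x,y]$ vanishes at every point of $U$. Let $\Lambda_{n,n}$ be the graph on $\{0,\dots,n-1\}^2$ in which $(a,b)$ and $(a',b')$ are adjacent if and only if $\min(|a-a'|,n-|a-a'|)+\min(|b-b'|,n-|b-b'|)=1$, and let $|\mathrm G\rangle$ be its cluster state on $n^2$ qubits, i.e. the unit vector, unique up to a phase, with $X_iZ_{N(i)}|\mathrm G\rangle=|\mathrm G\rangle$ for every vertex $i$, where $N(i)$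 is the set of neighbours of $i$. Then the quantum code $$\mathcal Q_U=\operatorname{span}\{Z_{\mathbf c}|\mathrm G\rangle:\mathbf c\in C_U\}$$ is a pure $[[(2^{4r}-1)^2,\,(2^{4r}-1)^2-32r-7,\,5]]$ quantum code. Here $Z_{\mathbf c}=\prod_jZ_j^{c_j}$, and a pure $[[N,k,d]]$ quantum code is a $2^k$-dimensional subspace $\mathcal Q$ of $(\mathbb C^2)^{\otimes N}$ such that $\langle\psi|E|\psi\rangle=0$ for all $|\psi\rangle\in\mathcal Q$ and all $N$-qubit Pauli operators $E$ of weight strictly between $0$ and $d$. -/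

import Mathlib

open scoped Matrix

noncomputable section

/-! ### Qubits and Pauli operators

The qubits are indexed by a finite type `V`. The Hilbert space `(ℂ²)^{⊗ V}` is written in its
computational basis, which is indexed by the bit strings `V → Fin 2`. -/

/-- Vectors of `(ℂ²)^{⊗ V}`, given by their coordinates in the computational basis. -/
abbrev QVec (V : Type*) : Type _ := (V → Fin 2) → ℂ

/-- Labels of the four single-qubit Pauli operators. -/
inductive Pauli where
  | I
  | X
  | Y
  | Z
  deriving DecidableEq

/-- The single-qubit Pauli matrices. -/
def Pauli.mat : Pauli → Matrix (Fin 2) (Fin 2) ℂ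
  | .I => 1
  | .X => !![0, 1; 1, 0]
  | .Y => !![0, -Complex.I; Complex.I, 0]
  | .Z => !![1, 0; 0, -1]

/-- The Pauli operator `⨂_{j ∈ V} σ j`, as a matrix in the computational basis. -/
def pauliOp {V : Type*} [Fintype V] (σ : V → Pauli) : Matrix (V → Fin 2) (V → Fin 2) ℂ :=
  Matrix.of fun x y => ∏ j, (σ j).mat (x j) (y j)

/-- The weight of a Pauli operator: the number of qubits on which it is not the identity. -/
def pauliWeight {V : Type*} [Fintype V] (σ : V → Pauli) : ℕ :=
  (Finset.univ.filter fun j => σ j ≠ Pauli.I).card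

/-- The Pauli string `Z_c = ∏_j Z_j ^ (c j)` of a binary vector `c`. -/
def pauliZ {V : Type*} (c : V → ZMod 2) : V → Pauli :=
  fun j => if c j = 1 then Pauli.Z else Pauli.I

/-- `⟨φ|ψ⟩`, conjugate-linear in `φ`. -/
def braket {V : Type*} [Fintype V] [DecidableEq V] (φ ψ : QVec V) : ℂ :=
  star φ ⬝ᵥ ψ

/-! ### Pure quantum codes -/

/-- `Q` is a pure `[[N, k, d]]` quantum code: a `2 ^ k`-dimensional subspace of the space of `N`
qubits such that `⟨ψ|E|ψ⟩ = 0` for all `ψ ∈ Q` and all Pauli operators `E` of weight strictly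
between `0` and `d`. (A global phase `±1, ±i` in front of `E` does not affect the condition, so
`E` ranges over the tensor products of Pauli matrices.) -/
structure IsPureQECC {V : Type*} [Fintype V] [DecidableEq V] (N k d : ℕ)
    (Q : Submodule ℂ (QVec V)) : Prop where
  card_qubits : Fintype.card V = N
  finrank_eq : Module.finrank ℂ Q = 2 ^ k
  pure : ∀ σ : V → Pauli, 0 < pauliWeight σ → pauliWeight σ < d →
    ∀ ψ ∈ Q, braket ψ (pauliOp σ *ᵥ ψ) = 0

/-! ### Graph states and CWS codes -/

open Classical in
/-- The stabilizer generator `S_i = X_i Z_{N(i)}` of a graph. -/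
def graphStabilizer {V : Type*} (G : SimpleGraph V) (i : V) : V → Pauli :=
  fun j => if j = i then Pauli.X else if G.Adj i j then Pauli.Z else Pauli.I

/-- `ψ` is a graph state of `G`: a unit vector that is a simultaneous `+1`-eigenvector of all
stabilizer generators of `G`. -/
structure IsGraphState {V : Type*} [Fintype V] [DecidableEq V] (G : SimpleGraph V)
    (ψ : QVec V) : Prop where
  unit : braket ψ ψ = 1
  stabilized : ∀ i, pauliOp (graphStabilizer G i) *ᵥ ψ = ψ

/-- The code `span {Z_c |ψ⟩ : c ∈ C}` of a state `ψ` and a binary linear code `C`. -/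
def cwsCode {V : Type*} [Fintype V] [DecidableEq V] (ψ : QVec V)
    (C : Submodule (ZMod 2) (V → ZMod 2)) : Submodule ℂ (QVec V) :=
  Submodule.span ℂ ((fun c : V → ZMod 2 => pauliOp (pauliZ c) *ᵥ ψ) '' (C : Set (V → ZMod 2)))

/-! ### The two-dimensional periodic lattice -/

/-- The Lee distance `min (|a - b|, n - |a - b|)` on `{0, …, n - 1}`. -/
def leeDist {n : ℕ} (a b : Fin n) : ℤ :=
  min |(a : ℤ) - (b : ℤ)| ((n : ℤ) - |(a : ℤ) - (b : ℤ)|)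

/-- The lattice `Λ_{n,m}` with periodic boundary conditions: vertices are joined iff their Lee
distance equals `1`. -/
def periodicLattice (n m : ℕ) : SimpleGraph (Fin n × Fin m) where
  Adj p q := leeDist p.1 q.1 + leeDist p.2 q.2 = 1
  symm := ⟨fun p q h => by
    simpa only [leeDist, abs_sub_comm] using h⟩
  loopless := ⟨fun p h => by
    simp [leeDist] at h⟩

/-! ### Two-dimensional cyclic codes -/

/-- The polynomial `∑ a_{i,j} x^i y^j` of a binary `n × n` array `a`
(the variables are `x = X 0` and `y = X 1`). -/
def arrayPoly (n : ℕ) :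
    (Fin n × Fin n → ZMod 2) →ₗ[ZMod 2] MvPolynomial (Fin 2) (ZMod 2) where
  toFun a := ∑ p, a p • (MvPolynomial.X 0 ^ (p.1 : ℕ) * MvPolynomial.X 1 ^ (p.2 : ℕ))
  map_add' a b := by simp only [Pi.add_apply, add_smul, Finset.sum_add_distrib]
  map_smul' c a := by
    simp only [Pi.smul_apply, smul_assoc, Finset.smul_sum, RingHom.id_apply]

/-- The two-dimensional cyclic code `C_U` of a set of points `U`: the binary `n × n` arrays whose
polynomial lies in the ideal `I(U)` of the polynomials over `𝔽₂` that vanish on `U`. -/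
def cyclicCode2D {F : Type*} [Field F] [Algebra (ZMod 2) F] (n : ℕ) (U : Set (Fin 2 → F)) :
    Submodule (ZMod 2) (Fin n × Fin n → ZMod 2) :=
  ((MvPolynomial.vanishingIdeal (ZMod 2) U).restrictScalars (ZMod 2)).comap (arrayPoly n)

/-- The set of eleven points that defines the code. -/
def definingSet {F : Type*} [Field F] (α β γ : F) : Set (Fin 2 → F) :=
  {![1, 1], ![α, α], ![α, α⁻¹], ![α, 1], ![α ^ 3, 1], ![1, α], ![1, α ^ 3], ![1, γ],
    ![β, β ^ 2], ![α, α ^ 2], ![α ^ 3, (α ^ 3)⁻¹]}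

/-! ### Every graph has a graph state -/

private lemma pauliOp_graphStabilizer_mulVec {V : Type*} [Fintype V] [DecidableEq V]
    (G : SimpleGraph V) [DecidableRel G.Adj] (i : V) (ψ : QVec V) (x : V → Fin 2) :
    (pauliOp (graphStabilizer G i) *ᵥ ψ) x =
      (∏ j, if G.Adj i j ∧ x j = 1 then (-1 : ℂ) else 1) *
        ψ (Function.update x i (1 - x i)) := by
  have hent : ∀ y, pauliOp (graphStabilizer G i) x y =
      if y = Function.update x i (1 - x i) then
        (∏ j, if G.Adj i j ∧ x j = 1 then (-1 : ℂ) else 1) else 0 := by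
    intro y
    split_ifs with h
    · subst h
      refine Finset.prod_congr rfl fun j _ => ?_
      by_cases hj : j = i
      · subst hj
        have : x j = 0 ∨ x j = 1 := by omega
        rcases this with h | h <;> simp [graphStabilizer, h, Pauli.mat]
      · rw [Function.update_of_ne hj]
        have : x j = 0 ∨ x j = 1 := by omega
        by_cases ha : G.Adj i j <;>
          rcases this with h | h <;> simp [graphStabilizer, h, hj, ha, Pauli.mat]
    · obtain ⟨j, hj⟩ := Function.ne_iff.mp h
      refine Finset.prod_eq_zero (Finset.mem_univ j) ?_
      have hx : x j = 0 ∨ x j = 1 := by omega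
      have hy : y j = 0 ∨ y j = 1 := by omega
      by_cases hji : j = i
      · subst hji
        rcases hx with h1 | h1 <;> rcases hy with h2 | h2 <;>
          simp_all [graphStabilizer, Pauli.mat]
      · by_cases ha : G.Adj i j <;>
        rcases hx with h1 | h1 <;> rcases hy with h2 | h2 <;>
          simp_all [graphStabilizer, Pauli.mat]
  simp [Matrix.mulVec, dotProduct, hent]

/-- The definition of a graph state is satisfiable for every finite graph. -/
theorem exists_isGraphState {V : Type*} [Fintype V] [DecidableEq V] (G : SimpleGraph V) :
    ∃ ψ : QVec V, IsGraphState G ψ := by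
  classical
  set f : (V → Fin 2) → V → V → ℂ := fun x a b =>
    if G.Adj a b ∧ x a = 1 ∧ x b = 1 then Complex.I else 1 with hf
  set g : QVec V := fun x => ∏ a, ∏ b, f x a b with hg
  have hnorm : ∀ x, star (g x) * g x = 1 := by
    intro x
    simp only [hg, star_prod, ← Finset.prod_mul_distrib]
    refine Finset.prod_eq_one fun a _ => Finset.prod_eq_one fun b _ => ?_
    simp only [hf]
    split_ifs <;> simp
  have hflip : ∀ i x, (∏ j, if G.Adj i j ∧ x j = 1 then (-1 : ℂ) else 1) *
      g (Function.update x i (1 - x i)) = g x := by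
    intro i x
    have hsplit : ∀ y, g y = (∏ j ∈ Finset.univ.erase i, (f y i j * f y j i)) *
        ∏ a ∈ Finset.univ.erase i, ∏ b ∈ Finset.univ.erase i, f y a b := by
      intro y
      have h1 : ∀ a, ∏ b, f y a b = f y a i * ∏ b ∈ Finset.univ.erase i, f y a b := fun a =>
        (Finset.mul_prod_erase _ _ (Finset.mem_univ i)).symm
      have h2 : f y i i = 1 := by simp [hf]
      simp only [hg]
      rw [← Finset.mul_prod_erase _ _ (Finset.mem_univ i), h1, h2,
        Finset.prod_congr rfl fun a _ => h1 a, Finset.prod_mul_distrib, Finset.prod_mul_distrib]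
      ring
    rw [hsplit x, hsplit (Function.update x i (1 - x i)),
      ← Finset.mul_prod_erase _ _ (Finset.mem_univ i), ← mul_assoc, mul_assoc (ite _ _ _),
      ← Finset.prod_mul_distrib]
    congr 1
    · simp only [SimpleGraph.irrefl, false_and, if_false, one_mul]
      refine Finset.prod_congr rfl fun j hj => ?_
      have hji : j ≠ i := Finset.ne_of_mem_erase hj
      have hx : x i = 0 ∨ x i = 1 := by omega
      have hy : x j = 0 ∨ x j = 1 := by omega
      by_cases ha : G.Adj i j
      · have ha' := ha.symm
        rcases hx with h1 | h1 <;> rcases hy with h2 | h2 <;>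
          simp [hf, h1, h2, ha, ha', hji]
      · have ha' : ¬ G.Adj j i := fun h => ha h.symm
        simp [hf, ha, ha']
    · refine Finset.prod_congr rfl fun a ha => Finset.prod_congr rfl fun b hb => ?_
      simp [hf, Finset.ne_of_mem_erase ha, Finset.ne_of_mem_erase hb]
  set c : ℝ := Real.sqrt ((Fintype.card (V → Fin 2) : ℝ)⁻¹) with hc
  refine ⟨(c : ℂ) • g, ?_, fun i => ?_⟩
  · have hcc : (c : ℂ) * (c : ℂ) = (Fintype.card (V → Fin 2) : ℂ)⁻¹ := by
      rw [← Complex.ofReal_mul, hc, Real.mul_self_sqrt (by positivity)]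
      push_cast
      rfl
    have hne : (Fintype.card (V → Fin 2) : ℂ) ≠ 0 := by
      exact_mod_cast Fintype.card_ne_zero
    have : ∀ x, star (((c : ℂ) • g) x) * ((c : ℂ) • g) x =
        (Fintype.card (V → Fin 2) : ℂ)⁻¹ := by
      intro x
      have := hnorm x
      simp only [Pi.smul_apply, smul_eq_mul, star_mul', ← hcc]
      rw [show star (c : ℂ) = (c : ℂ) from Complex.conj_ofReal c]
      linear_combination ((c : ℂ) * c) * this
    simp only [braket, dotProduct, Pi.star_apply, this, Finset.sum_const, Finset.card_univ,
      nsmul_eq_mul]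
    exact mul_inv_cancel₀ hne
  · funext x
    rw [Matrix.mulVec_smul, Pi.smul_apply, Pi.smul_apply, pauliOp_graphStabilizer_mulVec, hflip]

end

noncomputable section

/-! ### Tensor products of single-qubit operators -/

/-! The states `Z_c|G⟩` are simultaneous eigenvectors of the stabilizer generators with sign
patterns `c`, so they are orthonormal and the code has dimension `2 ^ dim C_U`. A Pauli operator `E`
shifts the pattern by its syndrome; hence `⟨φ|E|φ'⟩` vanishes on the code whenever the syndrome is
not in `C_U`. Since `0 ∈ C_U`, this also demands a nonzero syndrome, whence purity. Two classical
facts remain.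

Distance (`graphSyndrome_notMem_cyclicCode2D`). Evaluated at a point of `U`, an error at `(i, j)`
contributes `x^i y^j` times `1`, `g` or `1 + g` for type `Z`, `X` or `Y`, where `g = x + x⁻¹ + y +
y⁻¹`. In characteristic two `g = 0` at `(1,1)`, `(α,α)`, `(α,α⁻¹)`, `(α³,α⁻³)`, which therefore see
only `Z` and `Y`, while `g = 1` at `(β,β²)`, which sees only `X` and `Z`. Counting leaves errors of
pure type or two `Z` with two `Y` (`false_of_parity_checks`). In a pure type of weight four, power
sums pair up the `x`-coordinates and the `y`-coordinates, so the positions form a rectangle, which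
`(α,α²)` excludes (`false_of_four_points`). In the mixed case the ratios `x/y` pair up instead
(`false_of_two_points_two_points`).

Dimension (`finrank_cyclicCode2D_add_sum`). The kernels of evaluation at the points are distinct
maximal ideals, so by the Chinese remainder theorem the parity checks number the sum of the degrees
of the points, `1 + 2 + 4 + 8 · 4r = 32r + 7`. -/

/-- The operator `⨂_{j ∈ V} m j`, as a matrix in the computational basis. -/
def tensorOp {V : Type*} [Fintype V] (m : V → Matrix (Fin 2) (Fin 2) ℂ) :
    Matrix (V → Fin 2) (V → Fin 2) ℂ :=
  Matrix.of fun x y => ∏ j, m j (x j) (y j)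

section Quantum

variable {V : Type*} [Fintype V]

lemma pauliOp_eq_tensorOp (σ : V → Pauli) : pauliOp σ = tensorOp fun j => (σ j).mat := rfl

lemma tensorOp_smul (c : V → ℂ) (m : V → Matrix (Fin 2) (Fin 2) ℂ) :
    (tensorOp fun j => c j • m j) = (∏ j, c j) • tensorOp m := by
  ext x y
  simp [tensorOp, Finset.prod_mul_distrib]

lemma tensorOp_conjTranspose (m : V → Matrix (Fin 2) (Fin 2) ℂ) :
    (tensorOp m)ᴴ = tensorOp fun j => (m j)ᴴ := by
  ext x y
  simp [tensorOp, Matrix.conjTranspose_apply]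

lemma tensorOp_one : (tensorOp fun _ : V => 1) = 1 := by
  ext x y
  simp only [tensorOp, Matrix.of_apply, Matrix.one_apply]
  by_cases h : x = y
  · simp [h]
  · obtain ⟨j, hj⟩ := Function.ne_iff.mp h
    rw [if_neg h]
    exact Finset.prod_eq_zero (Finset.mem_univ j) (if_neg hj)

lemma Pauli.mat_conjTranspose (a : Pauli) : a.matᴴ = a.mat := by
  cases a <;> ext i j <;> fin_cases i <;> fin_cases j <;>
    simp [Pauli.mat, Matrix.conjTranspose_apply]

/-! ### Commutation of Pauli operators -/

/-- The exponent of `X` in a Pauli operator. -/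
def Pauli.xPart : Pauli → ZMod 2
  | .I => 0
  | .X => 1
  | .Y => 1
  | .Z => 0

/-- The exponent of `Z` in a Pauli operator. -/
def Pauli.zPart : Pauli → ZMod 2
  | .I => 0
  | .X => 0
  | .Y => 1
  | .Z => 1

/-- The sign `(-1) ^ c`. -/
def binSign (c : ZMod 2) : ℂ := if c = 1 then -1 else 1

lemma ZMod.two_cases (c : ZMod 2) : c = 0 ∨ c = 1 := by
  revert c; decide

lemma binSign_add (a b : ZMod 2) : binSign (a + b) = binSign a * binSign b := by
  have h : (1 : ZMod 2) + 1 = 0 := by decide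
  rcases ZMod.two_cases a with rfl | rfl <;> rcases ZMod.two_cases b with rfl | rfl <;>
    simp [binSign, h]

lemma binSign_sum {ι : Type*} (s : Finset ι) (f : ι → ZMod 2) :
    binSign (∑ j ∈ s, f j) = ∏ j ∈ s, binSign (f j) := by
  classical
  induction s using Finset.induction_on with
  | empty => simp [binSign]
  | insert a s ha ih => rw [Finset.sum_insert ha, Finset.prod_insert ha, binSign_add, ih]

lemma star_binSign (a : ZMod 2) : star (binSign a) = binSign a := by
  unfold binSign; split_ifs <;> simp

lemma Pauli.mat_mul_mat (a b : Pauli) :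
    a.mat * b.mat = binSign (a.xPart * b.zPart + a.zPart * b.xPart) • (b.mat * a.mat) := by
  have h : (1 : ZMod 2) + 1 = 0 := by decide
  cases a <;> cases b <;> ext i j <;> fin_cases i <;> fin_cases j <;>
    simp [Pauli.mat, Matrix.mul_apply, Pauli.xPart, Pauli.zPart, binSign, h]

/-! ### Syndromes with respect to a graph state -/

open Classical in
/-- The syndrome of a Pauli operator for the stabilizer generators of a graph. -/
def graphSyndrome (G : SimpleGraph V) (σ : V → Pauli) : V → ZMod 2 :=
  fun i => (σ i).zPart + ∑ j, if G.Adj i j then (σ j).xPart else 0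

/-- `Z_c` fails to commute with a generator only through its single factor `X_i`; codewords thus
serve directly as syndrome labels. -/
lemma graphSyndrome_pauliZ (G : SimpleGraph V) (c : V → ZMod 2) :
    graphSyndrome G (pauliZ c) = c := by
  funext i
  have hx : ∀ j, (pauliZ c j).xPart = 0 := fun j => by
    unfold pauliZ; split_ifs <;> rfl
  have hz : (pauliZ c i).zPart = c i := by
    rcases ZMod.two_cases (c i) with h | h <;> simp [pauliZ, h, Pauli.zPart]
  simp [graphSyndrome, hx, hz]

lemma pauliOp_conjTranspose (σ : V → Pauli) : (pauliOp σ)ᴴ = pauliOp σ := by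
  simp only [pauliOp_eq_tensorOp, tensorOp_conjTranspose, Pauli.mat_conjTranspose]

variable [DecidableEq V]

lemma tensorOp_mul (m m' : V → Matrix (Fin 2) (Fin 2) ℂ) :
    tensorOp m * tensorOp m' = tensorOp fun j => m j * m' j := by
  ext x y
  simp only [tensorOp, Matrix.mul_apply, Matrix.of_apply, ← Finset.prod_mul_distrib]
  rw [Finset.prod_univ_sum, Fintype.piFinset_univ]

lemma Pauli.mat_mul_self (a : Pauli) : a.mat * a.mat = 1 := by
  cases a <;> ext i j <;> fin_cases i <;> fin_cases j <;>
    simp [Pauli.mat, Matrix.mul_apply]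

lemma pauliOp_mul_self (σ : V → Pauli) : pauliOp σ * pauliOp σ = 1 := by
  simp only [pauliOp_eq_tensorOp, tensorOp_mul, Pauli.mat_mul_self, tensorOp_one]

lemma pauliOp_mul_pauliOp (σ τ : V → Pauli) :
    pauliOp σ * pauliOp τ =
      binSign (∑ j, ((σ j).xPart * (τ j).zPart + (σ j).zPart * (τ j).xPart)) •
        (pauliOp τ * pauliOp σ) := by
  simp only [pauliOp_eq_tensorOp, tensorOp_mul, binSign_sum]
  rw [← tensorOp_smul]
  exact congrArg tensorOp (funext fun j => Pauli.mat_mul_mat _ _)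

lemma graphStabilizer_mul_pauliOp (G : SimpleGraph V) (σ : V → Pauli) (i : V) :
    pauliOp (graphStabilizer G i) * pauliOp σ =
      binSign (graphSyndrome G σ i) • (pauliOp σ * pauliOp (graphStabilizer G i)) := by
  classical
  rw [pauliOp_mul_pauliOp]
  congr 2
  have h : ∀ j, (graphStabilizer G i j).xPart * (σ j).zPart +
      (graphStabilizer G i j).zPart * (σ j).xPart =
      (if j = i then (σ j).zPart else 0) + if G.Adj i j then (σ j).xPart else 0 := by
    intro j
    by_cases hj : j = i
    · subst hj; simp [graphStabilizer, Pauli.xPart, Pauli.zPart]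
    · by_cases ha : G.Adj i j <;> simp [graphStabilizer, hj, ha, Pauli.xPart, Pauli.zPart]
  simp only [h, Finset.sum_add_distrib, Finset.sum_ite_eq', Finset.mem_univ, if_true,
    graphSyndrome]

lemma braket_pauliOp_mulVec (σ : V → Pauli) (φ ψ : QVec V) :
    braket (pauliOp σ *ᵥ φ) (pauliOp σ *ᵥ ψ) = braket φ ψ := by
  rw [braket, Matrix.star_mulVec, ← Matrix.dotProduct_mulVec, Matrix.mulVec_mulVec,
    pauliOp_conjTranspose, pauliOp_mul_self, Matrix.one_mulVec, braket]

lemma braket_smul_smul (a b : ℂ) (φ ψ : QVec V) :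
    braket (a • φ) (b • ψ) = star a * b * braket φ ψ := by
  simp only [braket, star_smul, smul_dotProduct, dotProduct_smul, smul_eq_mul]
  ring

/-- A Pauli operator maps a simultaneous eigenvector of the stabilizer generators to another one,
whose eigenvalues are changed by the syndrome. -/
lemma graphStabilizer_mulVec_pauliOp_mulVec {G : SimpleGraph V} {φ : QVec V} {c : V → ZMod 2}
    (hφ : ∀ i, pauliOp (graphStabilizer G i) *ᵥ φ = binSign (c i) • φ) (σ : V → Pauli) (i : V) :
    pauliOp (graphStabilizer G i) *ᵥ (pauliOp σ *ᵥ φ) =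
      binSign ((graphSyndrome G σ + c) i) • (pauliOp σ *ᵥ φ) := by
  rw [Matrix.mulVec_mulVec, graphStabilizer_mul_pauliOp, Matrix.smul_mulVec,
    ← Matrix.mulVec_mulVec, hφ, Matrix.mulVec_smul, smul_smul, Pi.add_apply, binSign_add]

/-- A generator preserves inner products, and one where the eigenvalues differ turns the inner
product into its negative. -/
lemma braket_eq_zero_of_ne {G : SimpleGraph V} {φ φ' : QVec V} {c c' : V → ZMod 2}
    (hφ : ∀ i, pauliOp (graphStabilizer G i) *ᵥ φ = binSign (c i) • φ)
    (hφ' : ∀ i, pauliOp (graphStabilizer G i) *ᵥ φ' = binSign (c' i) • φ') (h : c ≠ c') :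
    braket φ φ' = 0 := by
  obtain ⟨i, hi⟩ := Function.ne_iff.mp h
  have h1 := braket_pauliOp_mulVec (graphStabilizer G i) φ φ'
  rw [hφ, hφ', braket_smul_smul, star_binSign] at h1
  have h2 : binSign (c i) * binSign (c' i) = -1 := by
    rcases ZMod.two_cases (c i) with h | h <;> rcases ZMod.two_cases (c' i) with h' | h' <;>
      simp_all [binSign]
  rw [h2] at h1
  linear_combination (-1 / 2 : ℂ) * h1

lemma IsGraphState.stabilizer_mulVec_pauliZ {G : SimpleGraph V} {ψ : QVec V}
    (hψ : IsGraphState G ψ) (c : V → ZMod 2) (i : V) :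
    pauliOp (graphStabilizer G i) *ᵥ (pauliOp (pauliZ c) *ᵥ ψ) =
      binSign (c i) • (pauliOp (pauliZ c) *ᵥ ψ) := by
  have h0 : ∀ i, pauliOp (graphStabilizer G i) *ᵥ ψ = binSign ((0 : V → ZMod 2) i) • ψ :=
    fun i => by simp [hψ.stabilized i, binSign]
  simpa [graphSyndrome_pauliZ] using graphStabilizer_mulVec_pauliOp_mulVec h0 (pauliZ c) i

lemma IsGraphState.finrank_cwsCode {G : SimpleGraph V} {ψ : QVec V} (hψ : IsGraphState G ψ)
    (C : Submodule (ZMod 2) (V → ZMod 2)) :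
    Module.finrank ℂ (cwsCode ψ C) = 2 ^ Module.finrank (ZMod 2) C := by
  classical
  set f : C → QVec V := fun c => pauliOp (pauliZ (c : V → ZMod 2)) *ᵥ ψ with hf
  have hli : LinearIndependent ℂ f := by
    rw [Fintype.linearIndependent_iff]
    intro g hg c
    have h1 : ∑ d, g d * braket (f c) (f d) = 0 := by
      have h2 : braket (f c) (∑ d, g d • f d) = 0 := by rw [hg, braket, dotProduct_zero]
      simpa only [braket, dotProduct_sum, dotProduct_smul, smul_eq_mul] using h2
    rw [Finset.sum_eq_single c] at h1
    · simpa [hf, braket_pauliOp_mulVec, hψ.unit] using h1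
    · intro d _ hd
      rw [braket_eq_zero_of_ne (hψ.stabilizer_mulVec_pauliZ (c : V → ZMod 2))
        (hψ.stabilizer_mulVec_pauliZ (d : V → ZMod 2))
        (fun h => hd (Subtype.ext h.symm)), mul_zero]
    · simp
  have hspan : cwsCode ψ C = Submodule.span ℂ (Set.range f) := by
    rw [cwsCode, Set.image_eq_range]
    rfl
  rw [hspan, finrank_span_eq_card hli, Module.card_eq_pow_finrank (K := ZMod 2), ZMod.card]

/-- By sesquilinearity it suffices to take `Z_c ψ` and `Z_d ψ`. A nonzero product would force `c` to
be the syndrome plus `d`, putting the syndrome `c - d` in the linear code. -/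
lemma IsGraphState.braket_cwsCode_eq_zero {G : SimpleGraph V} {ψ : QVec V}
    (hψ : IsGraphState G ψ) {C : Submodule (ZMod 2) (V → ZMod 2)} {σ : V → Pauli}
    (hσ : graphSyndrome G σ ∉ C) {φ φ' : QVec V} (hφ : φ ∈ cwsCode ψ C)
    (hφ' : φ' ∈ cwsCode ψ C) : braket φ (pauliOp σ *ᵥ φ') = 0 := by
  induction hφ using Submodule.span_induction with
  | zero => simp [braket]
  | add x y _ _ hx hy =>
    simp only [braket, star_add, add_dotProduct] at *
    rw [hx, hy, add_zero]
  | smul a x _ hx =>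
    simp only [braket, star_smul, smul_dotProduct] at *
    rw [hx, smul_zero]
  | mem x hx =>
    obtain ⟨c, hc, rfl⟩ := hx
    induction hφ' using Submodule.span_induction with
    | zero => simp [braket]
    | add x y _ _ hx hy =>
      simp only [braket, Matrix.mulVec_add, dotProduct_add] at *
      rw [hx, hy, add_zero]
    | smul a x _ hx =>
      simp only [braket, Matrix.mulVec_smul, dotProduct_smul] at *
      rw [hx, smul_zero]
    | mem x hx =>
      obtain ⟨d, hd, rfl⟩ := hx
      refine braket_eq_zero_of_ne (hψ.stabilizer_mulVec_pauliZ c)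
        (graphStabilizer_mulVec_pauliOp_mulVec (hψ.stabilizer_mulVec_pauliZ d) σ) fun h => hσ ?_
      rw [← add_sub_cancel_right (graphSyndrome G σ) d, ← h]
      exact C.sub_mem hc hd

end Quantum

/-! ### Evaluation of syndromes on the periodic lattice -/

lemma leeDist_nonneg {n : ℕ} (a b : Fin n) : 0 ≤ leeDist a b := by
  unfold leeDist
  rcases abs_cases ((a : ℤ) - (b : ℤ)) with ⟨h, _⟩ | ⟨h, _⟩ <;> rw [h] <;> omega

lemma leeDist_eq_zero_iff {n : ℕ} (a b : Fin n) : leeDist a b = 0 ↔ a = b := by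
  rw [Fin.ext_iff]
  unfold leeDist
  rcases abs_cases ((a : ℤ) - (b : ℤ)) with ⟨h, _⟩ | ⟨h, _⟩ <;> rw [h] <;> omega

lemma leeDist_eq_one_iff {n : ℕ} (hn : 3 ≤ n) (i j : Fin n) :
    leeDist i j = 1 ↔ i = ⟨((j : ℕ) + 1) % n, Nat.mod_lt _ (by omega)⟩ ∨
      i = ⟨((j : ℕ) + (n - 1)) % n, Nat.mod_lt _ (by omega)⟩ := by
  have hi := i.isLt
  have hj := j.isLt
  simp only [Fin.ext_iff]
  have h1 : ((j : ℕ) + 1) % n = if (j : ℕ) + 1 = n then 0 else (j : ℕ) + 1 := by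
    split_ifs with h
    · rw [h, Nat.mod_self]
    · exact Nat.mod_eq_of_lt (by omega)
  have h2 : ((j : ℕ) + (n - 1)) % n = if (j : ℕ) = 0 then n - 1 else (j : ℕ) - 1 := by
    split_ifs with h
    · rw [h, zero_add]; exact Nat.mod_eq_of_lt (by omega)
    · rw [show (j : ℕ) + (n - 1) = (j - 1) + n by omega, Nat.add_mod_right]
      exact Nat.mod_eq_of_lt (by omega)
  rw [h1, h2]
  unfold leeDist
  rcases abs_cases ((i : ℤ) - (j : ℤ)) with ⟨h, _⟩ | ⟨h, _⟩ <;> rw [h] <;> split_ifs <;> omega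

section

variable {F : Type*} [Field F]

/-- The neighbours of `j` on the cycle are `j ± 1` modulo `n`, and `x ^ n = 1` makes the wrap-around
invisible. -/
lemma sum_pow_leeDist_eq_one {n : ℕ} (hn : 3 ≤ n) {x : F} (hx : x ^ n = 1) (j : Fin n) :
    ∑ i : Fin n, (if leeDist i j = 1 then x ^ (i : ℕ) else 0) = x ^ (j : ℕ) * (x + x⁻¹) := by
  classical
  have hx0 : x ≠ 0 := by
    rintro rfl
    rw [zero_pow (by omega)] at hx
    exact zero_ne_one hx
  have hpow : ∀ m, x ^ (m % n) = x ^ m := fun m => (pow_eq_pow_mod m hx).symm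
  -- For `n = 2` the two neighbours would coincide and be counted once; `3 ≤ n` keeps them distinct.
  have hne : (⟨((j : ℕ) + 1) % n, Nat.mod_lt _ (by omega)⟩ : Fin n) ≠
      ⟨((j : ℕ) + (n - 1)) % n, Nat.mod_lt _ (by omega)⟩ := by
    rw [Ne, Fin.mk.injEq]
    intro h
    have h' : (j : ℕ) + 1 ≡ j + (n - 1) [MOD n] := h
    have h3 : 1 ≡ n - 1 [MOD n] := Nat.ModEq.add_left_cancel' _ h'
    unfold Nat.ModEq at h3
    rw [Nat.mod_eq_of_lt (by omega), Nat.mod_eq_of_lt (by omega)] at h3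
    omega
  simp only [leeDist_eq_one_iff hn]
  rw [← Finset.sum_filter, Finset.filter_or, Finset.filter_eq', Finset.filter_eq',
    if_pos (Finset.mem_univ _), if_pos (Finset.mem_univ _), ← Finset.insert_eq,
    Finset.sum_pair hne]
  simp only [hpow]
  have hinv : x ^ (n - 1) = x⁻¹ := by
    refine eq_inv_of_mul_eq_one_left ?_
    rw [← pow_succ, Nat.sub_add_cancel (by omega), hx]
  rw [pow_add, pow_add, hinv]
  ring

/-- The sum of the monomials of the neighbours of a vertex of the periodic lattice. -/
lemma sum_monomial_adj {n : ℕ} (hn : 3 ≤ n) {x y : F} (hx : x ^ n = 1) (hy : y ^ n = 1)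
    [DecidableRel (periodicLattice n n).Adj] (j : Fin n × Fin n) :
    ∑ i : Fin n × Fin n, (if (periodicLattice n n).Adj i j
        then x ^ (i.1 : ℕ) * y ^ (i.2 : ℕ) else 0) =
      (x + x⁻¹ + y + y⁻¹) * (x ^ (j.1 : ℕ) * y ^ (j.2 : ℕ)) := by
  classical
  have h : ∀ i : Fin n × Fin n, (if (periodicLattice n n).Adj i j
        then x ^ (i.1 : ℕ) * y ^ (i.2 : ℕ) else 0) =
      (if leeDist i.1 j.1 = 1 then x ^ (i.1 : ℕ) else 0) *
        (if i.2 = j.2 then y ^ (i.2 : ℕ) else 0) +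
      (if i.1 = j.1 then x ^ (i.1 : ℕ) else 0) *
        (if leeDist i.2 j.2 = 1 then y ^ (i.2 : ℕ) else 0) := by
    intro i
    have hadj : (periodicLattice n n).Adj i j ↔ leeDist i.1 j.1 + leeDist i.2 j.2 = 1 := Iff.rfl
    rw [if_congr hadj rfl rfl]
    have a1 := leeDist_nonneg i.1 j.1
    have a2 := leeDist_nonneg i.2 j.2
    simp only [← leeDist_eq_zero_iff]
    by_cases b1 : leeDist i.1 j.1 = 0
    · simp [b1]
    · by_cases b2 : leeDist i.2 j.2 = 0
      · simp [b2]
      · rw [if_neg (by omega), if_neg b2, if_neg b1]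
        ring
  simp only [h, Finset.sum_add_distrib]
  rw [Fintype.sum_prod_type, Fintype.sum_prod_type]
  simp only [← Finset.mul_sum, ← Finset.sum_mul, Finset.sum_ite_eq', Finset.mem_univ, if_true,
    sum_pow_leeDist_eq_one hn hx, sum_pow_leeDist_eq_one hn hy]
  ring

variable [Algebra (ZMod 2) F]

lemma aeval_arrayPoly {n : ℕ} (P : Fin 2 → F) (a : Fin n × Fin n → ZMod 2) :
    MvPolynomial.aeval P (arrayPoly n a) =
      ∑ p, algebraMap (ZMod 2) F (a p) * (P 0 ^ (p.1 : ℕ) * P 1 ^ (p.2 : ℕ)) := by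
  simp [arrayPoly, Algebra.smul_def]

/-- Exchanging the sums over positions and over their neighbours turns adjacency into multiplication
by the Laurent polynomial of the neighbourhood. -/
lemma aeval_arrayPoly_graphSyndrome {n : ℕ} (hn : 3 ≤ n) {P : Fin 2 → F} (hx : P 0 ^ n = 1)
    (hy : P 1 ^ n = 1) (σ : Fin n × Fin n → Pauli) :
    MvPolynomial.aeval P (arrayPoly n (graphSyndrome (periodicLattice n n) σ)) =
      ∑ j, (algebraMap (ZMod 2) F (σ j).zPart +
        algebraMap (ZMod 2) F (σ j).xPart * (P 0 + (P 0)⁻¹ + P 1 + (P 1)⁻¹)) *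
          (P 0 ^ (j.1 : ℕ) * P 1 ^ (j.2 : ℕ)) := by
  classical
  simp only [aeval_arrayPoly, graphSyndrome, map_add, map_sum, add_mul, Finset.sum_add_distrib,
    Finset.sum_mul]
  congr 1
  rw [Finset.sum_comm]
  simp only [mul_assoc]
  refine Finset.sum_congr rfl fun j _ => ?_
  rw [← sum_monomial_adj hn hx hy j, Finset.mul_sum]
  refine Finset.sum_congr rfl fun i _ => ?_
  split_ifs <;> simp

/-- The parity-check equation of a zero of the code, for an error of known syndrome, split
according to the type of the error. -/
lemma sum_filter_add_sum_filter_eq_zero {n : ℕ} (hn : 3 ≤ n) {P : Fin 2 → F} (hx : P 0 ^ n = 1)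
    (hy : P 1 ^ n = 1) {σ : Fin n × Fin n → Pauli}
    (h : MvPolynomial.aeval P (arrayPoly n (graphSyndrome (periodicLattice n n) σ)) = 0) :
    ∑ j with σ j = .Z, P 0 ^ (j.1 : ℕ) * P 1 ^ (j.2 : ℕ) +
      (P 0 + (P 0)⁻¹ + P 1 + (P 1)⁻¹) * ∑ j with σ j = .X, P 0 ^ (j.1 : ℕ) * P 1 ^ (j.2 : ℕ) +
      (1 + (P 0 + (P 0)⁻¹ + P 1 + (P 1)⁻¹)) *
        ∑ j with σ j = .Y, P 0 ^ (j.1 : ℕ) * P 1 ^ (j.2 : ℕ) = 0 := by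
  rw [aeval_arrayPoly_graphSyndrome hn hx hy] at h
  rw [← h, Finset.sum_filter, Finset.sum_filter, Finset.sum_filter, Finset.mul_sum,
    Finset.mul_sum, ← Finset.sum_add_distrib, ← Finset.sum_add_distrib]
  refine Finset.sum_congr rfl fun j _ => ?_
  rcases hσ : σ j <;> simp [Pauli.xPart, Pauli.zPart]

end

/-! ### Small sets of points in characteristic two -/

section

variable {F : Type*} [Field F] [CharP F 2]

/-- The binary code with zeros `1` and `3` has no word of weight at most four without
repetitions. -/
lemma eq_pairs_of_sum_eq_zero_of_sum_cube_eq_zero {a b c d : F} (h1 : a + b + c + d = 0)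
    (h3 : a ^ 3 + b ^ 3 + c ^ 3 + d ^ 3 = 0) :
    a = b ∧ c = d ∨ a = c ∧ b = d ∨ a = d ∧ b = c := by
  have h2 : (2 : F) = 0 := CharTwo.two_eq_zero
  have hd : d = a + b + c := by linear_combination h1 - (a + b + c) * h2
  subst hd
  -- In characteristic two, `a³ + b³ + c³ + (a + b + c)³ = (a + b)(a + c)(b + c)`.
  have hp : (a - b) * ((a - c) * (b - c)) = 0 := by
    linear_combination h3 - (a ^ 3 + b ^ 3 + c ^ 3 + a ^ 2 * b + 2 * a ^ 2 * c + 2 * a * b ^ 2 +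
      a * c ^ 2 + b ^ 2 * c + 2 * b * c ^ 2 + 3 * a * b * c) * h2
  rcases mul_eq_zero.mp hp with h | h
  · left
    exact ⟨sub_eq_zero.mp h, by linear_combination -h - b * h2⟩
  rcases mul_eq_zero.mp h with h | h
  · right; left
    exact ⟨sub_eq_zero.mp h, by linear_combination -h - c * h2⟩
  · right; right
    exact ⟨by linear_combination -h - c * h2, sub_eq_zero.mp h⟩

/-- Four distinct points cannot satisfy these five power-sum equations. -/
lemma false_of_four_points {x₁ x₂ x₃ x₄ y₁ y₂ y₃ y₄ : F}
    (h12 : x₁ = x₂ → y₁ ≠ y₂) (h13 : x₁ = x₃ → y₁ ≠ y₃) (h14 : x₁ = x₄ → y₁ ≠ y₄)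
    (hx : x₁ + x₂ + x₃ + x₄ = 0) (hx3 : x₁ ^ 3 + x₂ ^ 3 + x₃ ^ 3 + x₄ ^ 3 = 0)
    (hy : y₁ + y₂ + y₃ + y₄ = 0) (hy3 : y₁ ^ 3 + y₂ ^ 3 + y₃ ^ 3 + y₄ ^ 3 = 0)
    (hxy : x₁ * y₁ ^ 2 + x₂ * y₂ ^ 2 + x₃ * y₃ ^ 2 + x₄ * y₄ ^ 2 = 0) : False := by
  have h2 : (2 : F) = 0 := CharTwo.two_eq_zero
  -- The left side is the sum of `x y²` over the rectangle `{p, q} × {r, s}`, namely `(p + q)(r +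
  -- s)²`.
  have key : ∀ {p q r s : F}, p * r ^ 2 + p * s ^ 2 + q * r ^ 2 + q * s ^ 2 = 0 →
      p = q ∨ r = s := by
    intro p q r s h
    have h' : (p - q) * (r - s) ^ 2 = 0 := by
      linear_combination h - (q * r ^ 2 + q * s ^ 2 + p * r * s - q * r * s) * h2
    rcases mul_eq_zero.mp h' with h | h
    · exact .inl (sub_eq_zero.mp h)
    · exact .inr (sub_eq_zero.mp (pow_eq_zero_iff two_ne_zero |>.mp h))
  rcases eq_pairs_of_sum_eq_zero_of_sum_cube_eq_zero hx hx3 with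
    ⟨rfl, rfl⟩ | ⟨rfl, rfl⟩ | ⟨rfl, rfl⟩ <;>
  rcases eq_pairs_of_sum_eq_zero_of_sum_cube_eq_zero hy hy3 with
    ⟨rfl, rfl⟩ | ⟨rfl, rfl⟩ | ⟨rfl, rfl⟩ <;>
  -- If the two pairings agree, two points coincide. Otherwise the points form a rectangle, and
  -- `key` collapses one of its sides.
  first
  | exact h12 rfl rfl
  | exact h13 rfl rfl
  | exact h14 rfl rfl
  | (obtain h | h : x₁ = x₃ ∨ y₁ = y₂ := key (by linear_combination hxy)
     · first | exact h12 h rfl | exact h13 h rfl | exact h14 h rfl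
     · exact h12 rfl h)
  | (obtain h | h : x₁ = x₂ ∨ y₁ = y₃ := key (by linear_combination hxy)
     · first | exact h12 h rfl | exact h13 h rfl | exact h14 h rfl
     · first | exact h12 rfl h | exact h13 rfl h | exact h14 rfl h)
  | (obtain h | h : x₁ = x₂ ∨ y₁ = y₂ := key (by linear_combination hxy)
     · first | exact h12 h rfl | exact h13 h rfl | exact h14 h rfl
     · first | exact h12 rfl h | exact h13 rfl h | exact h14 rfl h)

/-- Two errors of type `Z` on a line through the origin and two errors of type `Y` on a line
through the origin cannot cancel. -/
lemma false_of_two_lines {t p q y₁ y₂ y₃ y₄ : F} (ht : t ≠ 0) (ht1 : 1 + t ≠ 0) (hp : p ≠ 0)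
    (h34 : y₃ ≠ y₄)
    (hprod : p * y₁ * y₁ + p * y₂ * y₂ + (q * y₃ * y₃ + q * y₄ * y₄) = 0)
    (hx : p * y₁ + p * y₂ + (1 + t) * (q * y₃ + q * y₄) = 0)
    (hy : y₁ + y₂ + (1 + t) * (y₃ + y₄) = 0) : False := by
  have h2 : (2 : F) = 0 := CharTwo.two_eq_zero
  have hw : y₃ + y₄ ≠ 0 := fun h => h34 (by linear_combination h - y₄ * h2)
  have hs : y₁ + y₂ = (1 + t) * (y₃ + y₄) := by
    linear_combination hy - (1 + t) * (y₃ + y₄) * h2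
  have hpq : (p - q) * ((1 + t) * (y₃ + y₄)) = 0 := by
    linear_combination hx - p * hs - q * (1 + t) * (y₃ + y₄) * h2
  obtain rfl : p = q := by
    rcases mul_eq_zero.mp hpq with h | h
    · exact sub_eq_zero.mp h
    · exact absurd h (mul_ne_zero ht1 hw)
  -- With `p = q`, `hprod` reads `p (y₁ + y₂)² = p (y₃ + y₄)²`; inserting `hs` leaves `(1 + t)² + 1
  -- = t²`.
  have hu : p * (t * (y₃ + y₄)) ^ 2 = 0 := by
    linear_combination hprod - p * (y₁ + y₂ + (1 + t) * (y₃ + y₄)) * hs +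
      p * (y₁ * y₂ + y₃ * y₄ - (1 + t) * (y₃ + y₄) ^ 2) * h2
  exact mul_ne_zero hp (pow_ne_zero 2 (mul_ne_zero ht hw)) hu

/-- Two errors of type `Z` and two errors of type `Y`, on the same two lines through the origin,
cannot cancel. -/
lemma false_of_common_lines {t p q y₁ y₂ y₃ y₄ : F} (ht : t ≠ 0) (ht1 : 1 + t ≠ 0) (hp : p ≠ 0)
    (hy₃ : y₃ ≠ 0) (h34 : p = q → y₃ ≠ y₄)
    (hprod : p * y₁ * y₁ + q * y₂ * y₂ + (p * y₃ * y₃ + q * y₄ * y₄) = 0)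
    (hx : p * y₁ + q * y₂ + (1 + t) * (p * y₃ + q * y₄) = 0)
    (hy : y₁ + y₂ + (1 + t) * (y₃ + y₄) = 0)
    (hxy : p * y₁ * y₁ ^ 2 + q * y₂ * y₂ ^ 2 +
      (1 + (t + t ^ 2)) * (p * y₃ * y₃ ^ 2 + q * y₄ * y₄ ^ 2) = 0) : False := by
  have h2 : (2 : F) = 0 := CharTwo.two_eq_zero
  by_cases hpq : p = q
  · subst hpq
    exact false_of_two_lines ht ht1 hp (h34 rfl) hprod hx hy
  have hA : (p - q) * (y₁ + (1 + t) * y₃) = 0 := by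
    linear_combination hx - q * hy
  have hA' := (mul_eq_zero.mp hA).resolve_left (sub_ne_zero.mpr hpq)
  have h1 : y₁ = (1 + t) * y₃ := by linear_combination hA' - (1 + t) * y₃ * h2
  have h3 : y₂ = (1 + t) * y₄ := by
    linear_combination hy - hA' - (1 + t) * y₄ * h2
  subst h1 h3
  -- The coefficients are `(1 + t)² + 1 = t²` here and `(1 + t)³ + 1 + t + t² = t³` below. The two
  -- relations then force `y₃ = y₄`, hence `p = q`.
  have hsq : t ^ 2 * (p * y₃ ^ 2 + q * y₄ ^ 2) = 0 := by
    linear_combination hprod - (1 + t) * (p * y₃ ^ 2 + q * y₄ ^ 2) * h2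
  have hcube : t ^ 3 * (p * y₃ ^ 3 + q * y₄ ^ 3) = 0 := by
    linear_combination hxy - (1 + 2 * t + 2 * t ^ 2) * (p * y₃ ^ 3 + q * y₄ ^ 3) * h2
  have hsq' := (mul_eq_zero.mp hsq).resolve_left (pow_ne_zero 2 ht)
  have hcube' := (mul_eq_zero.mp hcube).resolve_left (pow_ne_zero 3 ht)
  have h4 : p * y₃ ^ 2 * (y₃ - y₄) = 0 := by linear_combination hcube' - y₄ * hsq'
  have h5 : y₃ = y₄ :=
    sub_eq_zero.mp ((mul_eq_zero.mp h4).resolve_left (mul_ne_zero hp (pow_ne_zero 2 hy₃)))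
  subst h5
  have h6 : (p - q) * y₃ ^ 2 = 0 := by linear_combination hsq' - q * y₃ ^ 2 * h2
  exact hpq (sub_eq_zero.mp ((mul_eq_zero.mp h6).resolve_right (pow_ne_zero 2 hy₃)))

/-- Two errors of type `Z` and two errors of type `Y` cannot cancel. -/
lemma false_of_two_points_two_points {t x₁ x₂ x₃ x₄ y₁ y₂ y₃ y₄ : F} (ht : t ≠ 0)
    (ht1 : 1 + t ≠ 0)
    (hx₁ : x₁ ≠ 0) (hy₁ : y₁ ≠ 0) (hy₂ : y₂ ≠ 0) (hy₃ : y₃ ≠ 0) (hy₄ : y₄ ≠ 0)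
    (h34 : x₃ = x₄ → y₃ ≠ y₄)
    (hprod : x₁ * y₁ + x₂ * y₂ + (x₃ * y₃ + x₄ * y₄) = 0)
    (hdiv : x₁ / y₁ + x₂ / y₂ + x₃ / y₃ + x₄ / y₄ = 0)
    (hdiv3 : (x₁ / y₁) ^ 3 + (x₂ / y₂) ^ 3 + (x₃ / y₃) ^ 3 + (x₄ / y₄) ^ 3 = 0)
    (hx : x₁ + x₂ + (1 + t) * (x₃ + x₄) = 0)
    (hy : y₁ + y₂ + (1 + t) * (y₃ + y₄) = 0)
    (hxy : x₁ * y₁ ^ 2 + x₂ * y₂ ^ 2 +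
      (1 + (t + t ^ 2)) * (x₃ * y₃ ^ 2 + x₄ * y₄ ^ 2) = 0) : False := by
  -- Passing to slopes `u = x / y` puts each point on a line through the origin; the sums of slopes
  -- and of their cubes make the lines pair up.
  obtain ⟨u₁, hu₁⟩ : ∃ u, u = x₁ / y₁ := ⟨_, rfl⟩
  obtain ⟨u₂, hu₂⟩ : ∃ u, u = x₂ / y₂ := ⟨_, rfl⟩
  obtain ⟨u₃, hu₃⟩ : ∃ u, u = x₃ / y₃ := ⟨_, rfl⟩
  obtain ⟨u₄, hu₄⟩ : ∃ u, u = x₄ / y₄ := ⟨_, rfl⟩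
  rw [← hu₁, ← hu₂, ← hu₃, ← hu₄] at hdiv hdiv3
  rw [eq_div_iff hy₁] at hu₁
  rw [eq_div_iff hy₂] at hu₂
  rw [eq_div_iff hy₃] at hu₃
  rw [eq_div_iff hy₄] at hu₄
  subst hu₁ hu₂ hu₃ hu₄
  have hu₁ : u₁ ≠ 0 := left_ne_zero_of_mul hx₁
  rcases eq_pairs_of_sum_eq_zero_of_sum_cube_eq_zero hdiv hdiv3 with
    ⟨rfl, rfl⟩ | ⟨rfl, rfl⟩ | ⟨rfl, rfl⟩
  · exact false_of_two_lines ht ht1 hu₁ (fun h => h34 (by rw [h]) h) hprod hx hy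
  · exact false_of_common_lines ht ht1 hu₁ hy₃ (fun h h' => h34 (by rw [h, h']) h') hprod hx hy
      hxy
  -- The remaining pairing is the preceding one with the two `Y` errors exchanged.
  · exact false_of_common_lines (q := u₂) (y₁ := y₁) (y₂ := y₂) ht ht1 hu₁ hy₄
      (fun h h' => h34 (by rw [h, h']) h'.symm)
      (by linear_combination hprod) (by linear_combination hx) (by linear_combination hy)
      (by linear_combination hxy)

/-- Three fifth roots of unity do not sum to zero in characteristic two. -/
lemma add_add_ne_zero_of_pow_five_eq_one {a b c : F} (ha : a ^ 5 = 1) (hb : b ^ 5 = 1)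
    (hc : c ^ 5 = 1) : a + b + c ≠ 0 := by
  intro h
  have h2 : (2 : F) = 0 := CharTwo.two_eq_zero
  have hc0 : c ≠ 0 := by rintro rfl; simp at hc
  have key : ∀ s u : F, s ^ 5 = 1 → u ^ 5 = 1 → s + u + 1 = 0 → False := by
    intro s u hs hu hsu
    obtain rfl : u = 1 + s := by linear_combination hsu - (1 + s) * h2
    -- In characteristic two `(1 + s)⁵ = 1 + s + s⁴ + s⁵`. Multiplying the result by `s` gives `s² +
    -- s + 1 = 0`, so `s` has order dividing both `3` and `5`.
    have h4 : s ^ 4 + s + 1 = 0 := by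
      linear_combination hu - hs - (2 * s + 5 * s ^ 2 + 5 * s ^ 3 + 2 * s ^ 4) * h2
    have h3 : s ^ 2 + s + 1 = 0 := by linear_combination s * h4 - hs
    have hs3 : s ^ 3 = 1 := by linear_combination (s - 1) * h3
    have hs1 : s = 1 := by linear_combination (s ^ 3 + 1) * hs3 - s * hs
    subst hs1
    exact one_ne_zero (α := F) (by linear_combination h3 - h2)
  refine key (a / c) (b / c) (by rw [div_pow, ha, hc, div_one])
    (by rw [div_pow, hb, hc, div_one]) ?_
  field_simp
  linear_combination h

variable {ι : Type*} {x y : ι → F}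

lemma false_of_card_eq_four {W : Finset ι} (hinj : ∀ i j, x i = x j → y i = y j → i = j)
    (hW : W.card = 4) (hx : ∑ i ∈ W, x i = 0) (hx3 : ∑ i ∈ W, x i ^ 3 = 0)
    (hy : ∑ i ∈ W, y i = 0) (hy3 : ∑ i ∈ W, y i ^ 3 = 0)
    (hxy : ∑ i ∈ W, x i * y i ^ 2 = 0) : False := by
  classical
  obtain ⟨a, s, ha, rfl, hs⟩ := Finset.card_eq_succ.mp hW
  obtain ⟨b, c, d, hbc, hbd, hcd, rfl⟩ := Finset.card_eq_three.mp hs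
  simp only [Finset.mem_insert, Finset.mem_singleton, not_or] at ha
  have hsum : ∀ f : ι → F, ∑ i ∈ insert a {b, c, d}, f i = f a + f b + f c + f d := by
    intro f
    rw [Finset.sum_insert (by simp [ha]), Finset.sum_insert (by simp [hbc, hbd]),
      Finset.sum_pair hcd]
    ring
  rw [hsum] at hx hx3 hy hy3 hxy
  exact false_of_four_points (fun h h' => ha.1 (hinj _ _ h h'))
    (fun h h' => ha.2.1 (hinj _ _ h h')) (fun h h' => ha.2.2 (hinj _ _ h h')) hx hx3 hy hy3 hxy

/-- No nonempty set of at most four errors satisfies all parity-check equations. Here `Z`, `X`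
and `Y` are the sets of positions of the errors of the three types. -/
lemma false_of_parity_checks [DecidableEq ι] {X Y Z : Finset ι} {t : F}
    (hinj : ∀ i j, x i = x j → y i = y j → i = j)
    (hx0 : ∀ i, x i ≠ 0) (hy0 : ∀ i, y i ≠ 0) (ht : t ≠ 0) (ht1 : 1 + t ≠ 0)
    (ht2 : 1 + (t + t ^ 2) ≠ 0) (ht3 : 1 + (t + t ^ 3) ≠ 0)
    (hXY : Disjoint X Y) (hXZ : Disjoint X Z) (hYZ : Disjoint Y Z)
    (hpos : 0 < X.card + Y.card + Z.card) (hle : X.card + Y.card + Z.card ≤ 4)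
    (heven : ((Z.card + Y.card : ℕ) : F) = 0)
    (h1 : X.card + Z.card ≠ 1) (h3 : X.card + Z.card ≠ 3)
    (hmul : ∑ i ∈ Z, x i * y i + ∑ i ∈ Y, x i * y i = 0)
    (hdiv : ∑ i ∈ Z, x i / y i + ∑ i ∈ Y, x i / y i = 0)
    (hdiv3 : ∑ i ∈ Z, (x i / y i) ^ 3 + ∑ i ∈ Y, (x i / y i) ^ 3 = 0)
    (hx : ∑ i ∈ Z, x i + t * ∑ i ∈ X, x i + (1 + t) * ∑ i ∈ Y, x i = 0)
    (hx3 : ∑ i ∈ Z, x i ^ 3 + (t + t ^ 3) * ∑ i ∈ X, x i ^ 3 +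
      (1 + (t + t ^ 3)) * ∑ i ∈ Y, x i ^ 3 = 0)
    (hy : ∑ i ∈ Z, y i + t * ∑ i ∈ X, y i + (1 + t) * ∑ i ∈ Y, y i = 0)
    (hy3 : ∑ i ∈ Z, y i ^ 3 + (t + t ^ 3) * ∑ i ∈ X, y i ^ 3 +
      (1 + (t + t ^ 3)) * ∑ i ∈ Y, y i ^ 3 = 0)
    (hxy : ∑ i ∈ Z, x i * y i ^ 2 + (t + t ^ 2) * ∑ i ∈ X, x i * y i ^ 2 +
      (1 + (t + t ^ 2)) * ∑ i ∈ Y, x i * y i ^ 2 = 0) : False := by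
  have h2 : (2 : F) = 0 := CharTwo.two_eq_zero
  have ht23 : t + t ^ 2 ≠ 0 := by
    rw [show t + t ^ 2 = t * (1 + t) by ring]; exact mul_ne_zero ht ht1
  have ht33 : t + t ^ 3 ≠ 0 := by
    rw [show t + t ^ 3 = t * (1 + t) ^ 2 - t ^ 2 * 2 by ring, h2, mul_zero, sub_zero]
    exact mul_ne_zero ht (pow_ne_zero 2 ht1)
  have hdvd : 2 ∣ Z.card + Y.card := (CharP.cast_eq_zero_iff F 2 _).mp heven
  have hcancel : ∀ {c s : F}, c ≠ 0 → c * s = 0 → s = 0 := fun hc h =>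
    (mul_eq_zero.mp h).resolve_left hc
  -- Two positions with equal products `x y` and equal ratios `x / y` have equal `x²`, and squaring
  -- is injective.
  have hZY2 : Z.card + Y.card ≠ 2 := by
    intro h
    rw [add_comm, ← Finset.card_union_of_disjoint hYZ] at h
    rw [add_comm, ← Finset.sum_union hYZ] at hmul hdiv
    obtain ⟨p, q, hpq, hU⟩ := Finset.card_eq_two.mp h
    rw [hU, Finset.sum_pair hpq] at hmul hdiv
    have e1 : x p * y p = x q * y q := CharTwo.add_eq_zero.mp hmul
    have e2 : x p / y p = x q / y q := CharTwo.add_eq_zero.mp hdiv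
    have e3 : x p = x q := by
      have : x p ^ 2 = x q ^ 2 := by
        calc x p ^ 2 = x p * y p * (x p / y p) := by field_simp [hy0 p]
          _ = x q ^ 2 := by rw [e1, e2]; field_simp [hy0 q]
      exact CharTwo.sq_inj.mp this
    rw [e3] at e1
    exact hpq (hinj p q e3 (mul_left_cancel₀ (hx0 q) e1))
  -- `|Z| + |Y|` is even, at most four and not two.
  have hcase : Z = ∅ ∧ Y = ∅ ∨ X = ∅ ∧ Z.card + Y.card = 4 := by
    simp only [← Finset.card_eq_zero]
    omega
  rcases hcase with ⟨rfl, rfl⟩ | ⟨rfl, hZY⟩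
  · simp only [Finset.card_empty, Finset.sum_empty, zero_add, add_zero, mul_zero] at *
    have hx' := hcancel ht hx
    have hy' := hcancel ht hy
    rcases (show X.card = 2 ∨ X.card = 4 by omega) with hX | hX
    · obtain ⟨p, q, hpq, rfl⟩ := Finset.card_eq_two.mp hX
      rw [Finset.sum_pair hpq] at hx' hy'
      exact hpq (hinj p q (CharTwo.add_eq_zero.mp hx') (CharTwo.add_eq_zero.mp hy'))
    · exact false_of_card_eq_four hinj hX hx' (hcancel ht33 hx3) hy' (hcancel ht33 hy3)
        (hcancel ht23 hxy)
  · simp only [Finset.card_empty, Finset.sum_empty, zero_add, add_zero, mul_zero] at *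
    rcases (show Z.card = 0 ∨ Z.card = 2 ∨ Z.card = 4 by omega) with hZ | hZ | hZ
    · obtain rfl := Finset.card_eq_zero.mp hZ
      simp only [Finset.card_empty, Finset.sum_empty, zero_add] at *
      exact false_of_card_eq_four hinj hZY (hcancel ht1 hx) (hcancel ht3 hx3) (hcancel ht1 hy)
        (hcancel ht3 hy3) (hcancel ht2 hxy)
    · obtain ⟨a, b, hab, rfl⟩ := Finset.card_eq_two.mp hZ
      obtain ⟨c, d, hcd, rfl⟩ := Finset.card_eq_two.mp (show Y.card = 2 by omega)
      simp only [Finset.sum_pair hab, Finset.sum_pair hcd, ← add_assoc] at *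
      refine false_of_two_points_two_points ht ht1 (hx0 a) (hy0 a) (hy0 b) (hy0 c) (hy0 d)
        (fun h h' => hcd (hinj _ _ h h')) ?_ hdiv hdiv3 hx hy ?_
      · linear_combination hmul
      · linear_combination hxy
    · obtain rfl := Finset.card_eq_zero.mp (show Y.card = 0 by omega)
      simp only [Finset.sum_empty, mul_zero, add_zero] at *
      exact false_of_card_eq_four hinj hZ hx hx3 hy hy3 hxy

end

/-! ### Syndromes of errors of weight at most four -/

lemma fifteen_dvd_two_pow_sub_one (r : ℕ) : 15 ∣ 2 ^ (4 * r) - 1 := by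
  have h := Nat.sub_dvd_pow_sub_pow 16 1 r
  rw [one_pow] at h
  rwa [pow_mul]

lemma fifteen_le_two_pow_sub_one {r : ℕ} (hr : 1 ≤ r) : 15 ≤ 2 ^ (4 * r) - 1 := by
  have h : 2 ^ 4 ≤ 2 ^ (4 * r) := Nat.pow_le_pow_right (by norm_num) (by omega)
  omega

section

variable {F : Type*} [Field F]

lemma pow_eq_one_of_mem_definingSet {n : ℕ} {α β γ : F} (h15 : 15 ∣ n) (hα : α ^ n = 1)
    (hβ : β ^ 5 = 1) (hγ : γ ^ 3 = 1) {P : Fin 2 → F} (hP : P ∈ definingSet α β γ) (i : Fin 2) :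
    P i ^ n = 1 := by
  have hβn : β ^ n = 1 := by
    obtain ⟨m, rfl⟩ := h15
    rw [show 15 * m = 5 * (3 * m) by ring, pow_mul, hβ, one_pow]
  have hγn : γ ^ n = 1 := by
    obtain ⟨m, rfl⟩ := h15
    rw [show 15 * m = 3 * (5 * m) by ring, pow_mul, hγ, one_pow]
  have hα3 : ∀ k, (α ^ k) ^ n = 1 := fun k => by rw [← pow_mul, mul_comm, pow_mul, hα, one_pow]
  have hβ2 : (β ^ 2) ^ n = 1 := by rw [← pow_mul, mul_comm, pow_mul, hβn, one_pow]
  simp only [definingSet, Set.mem_insert_iff, Set.mem_singleton_iff] at hP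
  rcases hP with rfl | rfl | rfl | rfl | rfl | rfl | rfl | rfl | rfl | rfl | rfl <;>
    fin_cases i <;> simp [hα, hα3, hβn, hβ2, hγn]

variable [Algebra (ZMod 2) F]

lemma graphSyndrome_notMem_cyclicCode2D {n : ℕ} (hn : 15 ≤ n) (h15 : 15 ∣ n) {α β γ : F}
    (hα : IsPrimitiveRoot α n) (hβ : IsPrimitiveRoot β 5) (hγ : IsPrimitiveRoot γ 3)
    {σ : Fin n × Fin n → Pauli} (hpos : 0 < pauliWeight σ) (hlt : pauliWeight σ < 5) :
    graphSyndrome (periodicLattice n n) σ ∉ cyclicCode2D n (definingSet α β γ) := by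
  classical
  intro hmem
  have : CharP F 2 := charP_of_injective_algebraMap (algebraMap (ZMod 2) F).injective 2
  have h2 : (2 : F) = 0 := CharTwo.two_eq_zero
  have hα0 : α ≠ 0 := hα.ne_zero (by omega)
  have hne : ∀ k, 0 < k → k < 15 → α ^ k ≠ 1 := fun k h0 hk =>
    hα.pow_ne_one_of_pos_of_lt h0.ne' (by omega)
  have hcheck : ∀ P ∈ definingSet α β γ, ∑ j with σ j = .Z, P 0 ^ (j.1 : ℕ) * P 1 ^ (j.2 : ℕ) +
      (P 0 + (P 0)⁻¹ + P 1 + (P 1)⁻¹) * ∑ j with σ j = .X, P 0 ^ (j.1 : ℕ) * P 1 ^ (j.2 : ℕ) +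
      (1 + (P 0 + (P 0)⁻¹ + P 1 + (P 1)⁻¹)) *
        ∑ j with σ j = .Y, P 0 ^ (j.1 : ℕ) * P 1 ^ (j.2 : ℕ) = 0 := fun P hP =>
    sum_filter_add_sum_filter_eq_zero (by omega)
      (pow_eq_one_of_mem_definingSet h15 hα.pow_eq_one hβ.pow_eq_one hγ.pow_eq_one hP 0)
      (pow_eq_one_of_mem_definingSet h15 hα.pow_eq_one hβ.pow_eq_one hγ.pow_eq_one hP 1)
      (MvPolynomial.mem_vanishingIdeal_iff.mp hmem P hP)
  have hpow : ∀ (a : F) (k m : ℕ), (a ^ k) ^ m = (a ^ m) ^ k := fun a k m => by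
    rw [← pow_mul, mul_comm, pow_mul]
  have hdisj : ∀ p q : Pauli, p ≠ q →
      Disjoint (Finset.univ.filter fun j => σ j = p) (Finset.univ.filter fun j => σ j = q) :=
    fun p q hpq => Finset.disjoint_filter.mpr fun j _ h h' => hpq (h ▸ h')
  set X := Finset.univ.filter fun j => σ j = .X with hX
  set Y := Finset.univ.filter fun j => σ j = .Y with hY
  set Z := Finset.univ.filter fun j => σ j = .Z with hZ
  have hXY : Disjoint X Y := hdisj _ _ (by decide)
  have hXZ : Disjoint X Z := hdisj _ _ (by decide)
  have hYZ : Disjoint Y Z := hdisj _ _ (by decide)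
  have hcard : X.card + Y.card + Z.card = pauliWeight σ := by
    rw [← Finset.card_union_of_disjoint hXY, ← Finset.card_union_of_disjoint
      (Finset.disjoint_union_left.mpr ⟨hXZ, hYZ⟩), pauliWeight]
    congr 1
    ext j
    cases h : σ j <;> simp [hX, hY, hZ, h]
  -- the point `(β, β²)`
  have hβsum : ∑ j ∈ X ∪ Z, β ^ ((j.1 : ℕ) + 2 * (j.2 : ℕ)) = 0 := by
    -- These are the four nontrivial fifth roots of unity, with sum `-1 = 1`; the coefficient `1 +
    -- g` of the `Y` errors therefore vanishes.
    have hg : β + β⁻¹ + β ^ 2 + (β ^ 2)⁻¹ = 1 := by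
      have hb := hβ.geom_sum_eq_zero (by norm_num)
      simp only [Finset.sum_range_succ, Finset.sum_range_zero] at hb
      have h1 : β⁻¹ = β ^ 4 := inv_eq_of_mul_eq_one_right (by rw [← hβ.pow_eq_one]; ring)
      have h3 : (β ^ 2)⁻¹ = β ^ 3 := inv_eq_of_mul_eq_one_right (by rw [← hβ.pow_eq_one]; ring)
      rw [h1, h3]
      linear_combination hb - h2
    have h := hcheck ![β, β ^ 2] (by simp [definingSet])
    simp only [Matrix.cons_val_zero, Matrix.cons_val_one, hg, ← pow_mul, ← pow_add] at h
    rw [Finset.sum_union hXZ]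
    linear_combination h - (∑ j ∈ Y, β ^ ((j.1 : ℕ) + 2 * (j.2 : ℕ))) * h2
  have hβ5 : ∀ m, (β ^ m) ^ 5 = 1 := fun m => by rw [hpow, hβ.pow_eq_one, one_pow]
  have hXZ1 : X.card + Z.card ≠ 1 := by
    rw [← Finset.card_union_of_disjoint hXZ]
    intro h
    obtain ⟨a, ha⟩ := Finset.card_eq_one.mp h
    rw [ha, Finset.sum_singleton] at hβsum
    exact pow_ne_zero _ (hβ.ne_zero (by norm_num)) hβsum
  have hXZ3 : X.card + Z.card ≠ 3 := by
    rw [← Finset.card_union_of_disjoint hXZ]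
    intro h
    obtain ⟨a, b, c, hab, hac, hbc, hU⟩ := Finset.card_eq_three.mp h
    rw [hU, Finset.sum_insert (by simp [hab, hac]), Finset.sum_pair hbc, ← add_assoc] at hβsum
    exact add_add_ne_zero_of_pow_five_eq_one (hβ5 _) (hβ5 _) (hβ5 _) hβsum
  -- the values of the neighbourhood polynomial
  set t := α + α⁻¹ with ht
  have hinv : α * α⁻¹ = 1 := mul_inv_cancel₀ hα0
  have g1 : ∀ a : F, a + 1 + 1 = a := fun a => by linear_combination h2
  have g3 : α ^ 3 + (α ^ 3)⁻¹ = t + t ^ 3 := by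
    rw [ht]
    field_simp
    linear_combination (-2 * α ^ 4 - 2 * α ^ 2) * h2
  have g2 : t + α ^ 2 + (α ^ 2)⁻¹ = t + t ^ 2 := by
    rw [ht]
    field_simp
    linear_combination (-α ^ 2) * h2
  refine false_of_parity_checks (X := X) (Y := Y) (Z := Z) (t := t)
    (x := fun j : Fin n × Fin n => α ^ (j.1 : ℕ)) (y := fun j => α ^ (j.2 : ℕ))
    (fun i j hi hj => Prod.ext (Fin.ext (hα.pow_inj i.1.isLt j.1.isLt hi))
      (Fin.ext (hα.pow_inj i.2.isLt j.2.isLt hj)))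
    (fun _ => pow_ne_zero _ hα0) (fun _ => pow_ne_zero _ hα0) ?_ ?_ ?_ ?_ hXY hXZ hYZ
    (by omega) (by omega) ?_ hXZ1 hXZ3 ?_ ?_ ?_ ?_ ?_ ?_ ?_ ?_
  -- Clearing denominators, vanishing of `t`, `1 + t`, `1 + t + t²`, `1 + t + t³` would give `α ^ k
  -- = 1` for `k = 2, 3, 5, 9` respectively, all below the order of `α`.
  · intro h
    refine hne 2 (by norm_num) (by norm_num) ?_
    linear_combination α * h - hinv - h2
  · intro h
    refine hne 3 (by norm_num) (by norm_num) ?_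
    linear_combination (α - 1) * α * h - (α - 1) * hinv
  · intro h
    rw [← g2] at h
    refine hne 5 (by norm_num) (by norm_num) ?_
    rw [ht] at h
    field_simp at h
    linear_combination (α - 1) * h
  · intro h
    rw [← g3] at h
    refine hne 9 (by norm_num) (by norm_num) ?_
    field_simp at h
    linear_combination (α ^ 3 - 1) * h
  · have h := hcheck ![1, 1] (by simp [definingSet])
    simp only [Matrix.cons_val_zero, Matrix.cons_val_one, inv_one, one_pow, mul_one,
      Finset.sum_const, nsmul_eq_mul] at h
    push_cast
    linear_combination h - (2 * (X.card : F) + 2 * Y.card) * h2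
  · have h := hcheck ![α, α] (by simp [definingSet])
    simp only [Matrix.cons_val_zero, Matrix.cons_val_one] at h
    linear_combination h - (t * (∑ j ∈ X, α ^ (j.1 : ℕ) * α ^ (j.2 : ℕ)) +
      t * ∑ j ∈ Y, α ^ (j.1 : ℕ) * α ^ (j.2 : ℕ)) * h2
  · have h := hcheck ![α, α⁻¹] (by simp [definingSet])
    simp only [Matrix.cons_val_zero, Matrix.cons_val_one, inv_inv, inv_pow, ← div_eq_mul_inv] at h
    linear_combination h - (t * (∑ j ∈ X, α ^ (j.1 : ℕ) / α ^ (j.2 : ℕ)) +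
      t * ∑ j ∈ Y, α ^ (j.1 : ℕ) / α ^ (j.2 : ℕ)) * h2
  · have h := hcheck ![α ^ 3, (α ^ 3)⁻¹] (by simp [definingSet])
    simp only [Matrix.cons_val_zero, Matrix.cons_val_one, inv_inv, inv_pow _ (_ : ℕ),
      hpow α 3, ← div_eq_mul_inv, ← div_pow] at h
    linear_combination h - ((α ^ 3 + (α ^ 3)⁻¹) * (∑ j ∈ X, (α ^ (j.1 : ℕ) / α ^ (j.2 : ℕ)) ^ 3) +
      (α ^ 3 + (α ^ 3)⁻¹) * ∑ j ∈ Y, (α ^ (j.1 : ℕ) / α ^ (j.2 : ℕ)) ^ 3) * h2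
  · have h := hcheck ![α, 1] (by simp [definingSet])
    simpa only [Matrix.cons_val_zero, Matrix.cons_val_one, inv_one, one_pow, mul_one, g1] using h
  · have h := hcheck ![α ^ 3, 1] (by simp [definingSet])
    simpa only [Matrix.cons_val_zero, Matrix.cons_val_one, inv_one, one_pow, mul_one, g1, g3,
      hpow α 3] using h
  · have h := hcheck ![1, α] (by simp [definingSet])
    simpa only [Matrix.cons_val_zero, Matrix.cons_val_one, inv_one, one_pow, one_mul, add_assoc,
      ← add_assoc (1 : F) 1, CharTwo.add_self_eq_zero, zero_add] using h
  · have h := hcheck ![1, α ^ 3] (by simp [definingSet])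
    rw [← g3]
    simpa only [Matrix.cons_val_zero, Matrix.cons_val_one, inv_one, one_pow, one_mul, hpow α 3,
      add_assoc, ← add_assoc (1 : F) 1, CharTwo.add_self_eq_zero, zero_add] using h
  · have h := hcheck ![α, α ^ 2] (by simp [definingSet])
    simpa only [Matrix.cons_val_zero, Matrix.cons_val_one, ← ht, g2, hpow α 2] using h

end

/-! ### The dimension of a two-dimensional cyclic code -/

section

variable {F : Type*} [Field F] [Algebra (ZMod 2) F]

/-- Reducing exponents modulo `n` changes no value at points whose coordinates are `n`-th roots of
unity, so arrays realise all polynomial values. -/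
lemma exists_arrayPoly_aeval_eq {ι : Type*} {n : ℕ} (hn : 0 < n) (P : ι → Fin 2 → F)
    (hP : ∀ k i, P k i ^ n = 1) (p : MvPolynomial (Fin 2) (ZMod 2)) :
    ∃ a : Fin n × Fin n → ZMod 2, ∀ k,
      MvPolynomial.aeval (P k) (arrayPoly n a) = MvPolynomial.aeval (P k) p := by
  classical
  induction p using MvPolynomial.induction_on' with
  | monomial s c =>
    refine ⟨Pi.single (⟨s 0 % n, Nat.mod_lt _ hn⟩, ⟨s 1 % n, Nat.mod_lt _ hn⟩) c, fun k => ?_⟩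
    rw [aeval_arrayPoly, Finset.sum_eq_single
      (⟨s 0 % n, Nat.mod_lt _ hn⟩, ⟨s 1 % n, Nat.mod_lt _ hn⟩)]
    · rw [Pi.single_eq_same, MvPolynomial.aeval_monomial, Finsupp.prod_fintype _ _ (by simp),
        Fin.prod_univ_two, ← pow_eq_pow_mod _ (hP k 0), ← pow_eq_pow_mod _ (hP k 1)]
    · intro b _ hb
      rw [Pi.single_eq_of_ne hb, map_zero, zero_mul]
    · simp
  | add p q hp hq =>
    obtain ⟨a, ha⟩ := hp
    obtain ⟨b, hb⟩ := hq
    exact ⟨a + b, fun k => by rw [map_add, map_add, map_add, ha, hb]⟩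

/-- The code of a set of pairwise non-conjugate points has as many parity checks as the sum of
the degrees of the points. -/
lemma finrank_cyclicCode2D_add_sum [Finite F] {ι : Type*} [Fintype ι] {n : ℕ} (hn : 0 < n)
    (P : ι → Fin 2 → F) (hP : ∀ k i, P k i ^ n = 1)
    (hker : Function.Injective fun k =>
      RingHom.ker (MvPolynomial.aeval (P k) : MvPolynomial (Fin 2) (ZMod 2) →ₐ[ZMod 2] F)) :
    Module.finrank (ZMod 2) (cyclicCode2D n (Set.range P)) +
      ∑ k, Module.finrank (ZMod 2)
        (MvPolynomial.aeval (P k) : MvPolynomial (Fin 2) (ZMod 2) →ₐ[ZMod 2] F).range = n ^ 2 := by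
  classical
  set φ : ι → (MvPolynomial (Fin 2) (ZMod 2) →ₐ[ZMod 2] F) := fun k =>
    MvPolynomial.aeval (P k) with hφ
  have hfin : Module.Finite (ZMod 2) F := Module.Finite.of_finite
  -- The image is a subalgebra of a finite field, hence itself a field.
  have hmax : ∀ k, (RingHom.ker (φ k)).IsMaximal := fun k => by
    have hf : IsField (φ k).range := Subalgebra.isField_of_algebraic _
    let _ := hf.toField
    have h : RingHom.ker (φ k) = RingHom.ker (φ k).rangeRestrict := by
      rw [AlgHom.ker_rangeRestrict]
    rw [h]
    exact RingHom.ker_isMaximal_of_surjective (K := (φ k).range) (φ k).rangeRestrict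
      (φ k).rangeRestrict_surjective
  have hcop : Pairwise (Function.onFun IsCoprime fun k => RingHom.ker (φ k)) := by
    intro k l hkl
    have := hmax k
    have := hmax l
    exact Ideal.isCoprime_of_isMaximal (hker.ne hkl)
  set Φ : (Fin n × Fin n → ZMod 2) →ₗ[ZMod 2] (∀ k, (φ k).range) :=
    LinearMap.pi fun k => (φ k).rangeRestrict.toLinearMap ∘ₗ arrayPoly n with hΦ
  have hΦval : ∀ a k, ((Φ a k : (φ k).range) : F) = φ k (arrayPoly n a) := fun a k => rfl
  have hsurj : Function.Surjective Φ := by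
    intro v
    choose f hf using fun k => (v k).2
    obtain ⟨p, hp⟩ := Ideal.exists_forall_sub_mem_ideal hcop f
    obtain ⟨a, ha⟩ := exists_arrayPoly_aeval_eq hn P hP p
    refine ⟨a, funext fun k => Subtype.ext ?_⟩
    have h1 := hp k
    rw [RingHom.mem_ker, map_sub, sub_eq_zero] at h1
    rw [hΦval, ← hf k]
    exact (ha k).trans h1
  have hkerΦ : LinearMap.ker Φ = cyclicCode2D n (Set.range P) := by
    ext a
    rw [LinearMap.mem_ker, funext_iff]
    change _ ↔ arrayPoly n a ∈ MvPolynomial.vanishingIdeal (ZMod 2) (Set.range P)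
    rw [MvPolynomial.mem_vanishingIdeal_iff, Set.forall_mem_range]
    refine forall_congr' fun k => ?_
    rw [← hΦval]
    exact Subtype.ext_iff
  have h := LinearMap.finrank_range_add_finrank_ker Φ
  rw [LinearMap.range_eq_top.mpr hsurj, finrank_top, hkerΦ, Module.finrank_pi_fintype,
    Module.finrank_fintype_fun_eq_card, Fintype.card_prod, Fintype.card_fin] at h
  rw [add_comm, h, sq]

/-- The degree `e` of the field generated by the coordinates of a point, which lies in a field
of `2 ^ d` elements and has a coordinate of order `m`. -/
lemma dvd_two_pow_finrank_range_aeval [Finite F] {P : Fin 2 → F} {d m : ℕ}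
    (hd : ∀ i, P i ^ 2 ^ d = P i) (i : Fin 2) (hi : IsPrimitiveRoot (P i) m) (hm : 0 < m) :
    m ∣ 2 ^ Module.finrank (ZMod 2)
        (MvPolynomial.aeval P : MvPolynomial (Fin 2) (ZMod 2) →ₐ[ZMod 2] F).range - 1 ∧
      2 ^ Module.finrank (ZMod 2)
        (MvPolynomial.aeval P : MvPolynomial (Fin 2) (ZMod 2) →ₐ[ZMod 2] F).range - 1 ∣
          2 ^ d - 1 := by
  classical
  have : CharP F 2 := charP_of_injective_algebraMap (algebraMap (ZMod 2) F).injective 2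
  have hfin : Module.Finite (ZMod 2) F := Module.Finite.of_finite
  set A := (MvPolynomial.aeval P : MvPolynomial (Fin 2) (ZMod 2) →ₐ[ZMod 2] F).range with hA
  have hfield : IsField A := Subalgebra.isField_of_algebraic _
  -- The `d`-th power of Frobenius is a ring homomorphism fixing the coordinates, hence all they
  -- generate.
  have hpow : ∀ z ∈ A, z ^ 2 ^ d = z := by
    rintro _ ⟨p, rfl⟩
    induction p using MvPolynomial.induction_on with
    | C a =>
      change MvPolynomial.aeval P (MvPolynomial.C a) ^ 2 ^ d =
        MvPolynomial.aeval P (MvPolynomial.C a)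
      rw [MvPolynomial.aeval_C, ← map_pow, ZMod.pow_card_pow]
    | add p q hp hq =>
      rw [map_add, add_pow_char_pow, hp, hq]
    | mul_X p j hp =>
      rw [map_mul, mul_pow, hp]
      congr 1
      change MvPolynomial.aeval P (MvPolynomial.X j) ^ 2 ^ d =
        MvPolynomial.aeval P (MvPolynomial.X j)
      rw [MvPolynomial.aeval_X, hd]
  let _ := Fintype.ofFinite A
  have hcard : Fintype.card A = 2 ^ Module.finrank (ZMod 2) A := by
    rw [Module.card_eq_pow_finrank (K := ZMod 2), ZMod.card]
  have hunits : Nat.card Aˣ = 2 ^ Module.finrank (ZMod 2) A - 1 := by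
    let _ := hfield.toField
    rw [← hcard, Nat.card_eq_fintype_card]
    exact Fintype.card_units A
  rw [← hunits]
  constructor
  · have hPi : P i ∈ A := ⟨MvPolynomial.X i, MvPolynomial.aeval_X P i⟩
    have hone : (⟨P i, hPi⟩ : A) ^ m = 1 := Subtype.ext hi.pow_eq_one
    obtain ⟨u, hu⟩ := IsUnit.of_pow_eq_one hone hm.ne'
    refine hi.dvd_of_pow_eq_one _ ?_
    have hcast : ((u : A) : F) = P i := congrArg Subtype.val hu
    rw [← hcast, ← SubmonoidClass.coe_pow, ← Units.val_pow_eq_pow_val, pow_card_eq_one']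
    rfl
  · obtain ⟨u, hu⟩ := IsCyclic.exists_ofOrder_eq_natCard (α := Aˣ)
    rw [← hu]
    refine orderOf_dvd_of_pow_eq_one (Units.ext (Subtype.ext ?_))
    have h := hpow (u : A) (u : A).2
    have hu0 : ((u : A) : F) ≠ 0 := by
      intro h0
      have h1 : (u : A) = 0 := Subtype.ext h0
      exact u.ne_zero h1
    refine mul_right_cancel₀ hu0 ?_
    simp only [Units.val_pow_eq_pow_val, SubmonoidClass.coe_pow, Units.val_one, OneMemClass.coe_one,
      one_mul]
    rw [← pow_succ, Nat.sub_add_cancel Nat.one_le_two_pow, h]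

end

/-! ### The dimension of the code of the defining set -/

section

variable {F : Type*} [Field F]

/-- The points of the defining set, indexed by their position in `pointIndex`. -/
def definingPoint (α β γ : F) : Fin 11 → Fin 2 → F :=
  ![![1, 1], ![1, γ], ![1, α ^ 3], ![1, α], ![α ^ 3, 1], ![α, 1], ![α, α],
    ![α ^ 3, (α ^ 3)⁻¹], ![α, α⁻¹], ![β, β ^ 2], ![α, α ^ 2]]

lemma range_definingPoint (α β γ : F) : Set.range (definingPoint α β γ) = definingSet α β γ := by
  ext P
  simp only [Set.mem_range, Fin.exists_fin_succ, definingPoint, definingSet,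
    Set.mem_insert_iff, Set.mem_singleton_iff, Matrix.cons_val_zero, Matrix.cons_val_succ,
    IsEmpty.exists_iff, or_false, eq_comm (b := P)]
  tauto

open Classical MvPolynomial in
/-- An invariant of the conjugacy class of a point, computed from the ideal of the point. -/
def pointIndex (m : ℕ) (I : Ideal (MvPolynomial (Fin 2) (ZMod 2))) : ℕ :=
  if X 0 - 1 ∈ I then
    if X 1 - 1 ∈ I then 0 else if X 1 ^ 3 - 1 ∈ I then 1 else if X 1 ^ m - 1 ∈ I then 2 else 3
  else if X 1 - 1 ∈ I then if X 0 ^ m - 1 ∈ I then 4 else 5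
  else if X 0 - X 1 ∈ I then 6
  else if X 0 * X 1 - 1 ∈ I then if X 0 ^ m - 1 ∈ I then 7 else 8
  else if X 0 ^ m - 1 ∈ I then 9 else 10

variable [Algebra (ZMod 2) F]

/-- Membership in the kernel tests a polynomial relation at the point. The `m`-th power separates
`α`, of order `3m`, from `α³` and from `β`, whose orders divide `m`. The cube test for `γ` comes
first because `γ ^ m` may or may not be `1`. -/
lemma pointIndex_ker_aeval {m : ℕ} (hm : 5 ∣ m) (hm0 : 0 < m) {α β γ : F}
    (hα : IsPrimitiveRoot α (3 * m)) (hβ : IsPrimitiveRoot β 5) (hγ : IsPrimitiveRoot γ 3)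
    (k : Fin 11) :
    pointIndex m (RingHom.ker (MvPolynomial.aeval (definingPoint α β γ k) :
      MvPolynomial (Fin 2) (ZMod 2) →ₐ[ZMod 2] F)) = k := by
  have hm5 : 5 ≤ m := Nat.le_of_dvd hm0 hm
  have hα0 : α ≠ 0 := hα.ne_zero (by omega)
  have hβ0 : β ≠ 0 := hβ.ne_zero (by omega)
  have hne : ∀ j, 0 < j → j < 3 * m → α ^ j ≠ 1 := fun j h0 hj =>
    hα.pow_ne_one_of_pos_of_lt h0.ne' hj
  have hα1 : α ≠ 1 := by simpa using hne 1 (by omega) (by omega)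
  have hα3 := hne 3 (by omega) (by omega)
  have hα33 : (α ^ 3) ^ 3 ≠ 1 := by rw [← pow_mul]; exact hne 9 (by omega) (by omega)
  have hαm := hne m hm0 (by omega)
  have hα3m : (α ^ 3) ^ m = 1 := by rw [← pow_mul, hα.pow_eq_one]
  have hαi : α ≠ α⁻¹ := fun h => hne 2 (by omega) (by omega) (by
    rw [sq]; nth_rewrite 2 [h]; exact mul_inv_cancel₀ hα0)
  have hα3i : α ^ 3 ≠ (α ^ 3)⁻¹ := fun h => hne 6 (by omega) (by omega) (by
    rw [show α ^ 6 = α ^ 3 * α ^ 3 by ring]; nth_rewrite 2 [h]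
    exact mul_inv_cancel₀ (pow_ne_zero 3 hα0))
  have hα2 : α ≠ α ^ 2 := fun h => hα1 (mul_left_cancel₀ hα0 (by rw [mul_one, ← sq, ← h]))
  have hαα2 : α * α ^ 2 ≠ 1 := by rw [← pow_succ']; exact hα3
  have hα21 : α ^ 2 ≠ 1 := hne 2 (by omega) (by omega)
  have hβ1 : β ≠ 1 := hβ.ne_one (by norm_num)
  have hβ21 : β ^ 2 ≠ 1 := hβ.pow_ne_one_of_pos_of_lt (by norm_num) (by norm_num)
  have hβ2 : β ≠ β ^ 2 := fun h => hβ1 (mul_left_cancel₀ hβ0 (by rw [mul_one, ← sq, ← h]))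
  have hββ2 : β * β ^ 2 ≠ 1 := by
    rw [← pow_succ']; exact hβ.pow_ne_one_of_pos_of_lt (by norm_num) (by norm_num)
  have hβm : β ^ m = 1 := hβ.pow_eq_one_iff_dvd m |>.mpr hm
  have hγ1 : γ ≠ 1 := hγ.ne_one (by norm_num)
  have hγ3 := hγ.pow_eq_one
  fin_cases k <;>
    simp [pointIndex, definingPoint, RingHom.mem_ker, sub_eq_zero, hα0, hα1, hα3, hα33, hαm, hα3m,
      hαi, hα3i, hα2, hαα2, hα21, hβ1, hβ21, hβ2, hββ2, hβm, hγ1, hγ3]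

/-- The degrees of the points of the defining set. -/
lemma finrank_range_aeval_definingPoint [Fintype F] {r m : ℕ} (hr : 1 ≤ r)
    (hm : 2 ^ (4 * r) - 1 = 3 * m)
    (hF : Fintype.card F = 2 ^ (4 * r)) {α β γ : F}
    (hα : IsPrimitiveRoot α (3 * m)) (hβ : IsPrimitiveRoot β 5) (hγ : IsPrimitiveRoot γ 3)
    (k : Fin 11) :
    Module.finrank (ZMod 2) (MvPolynomial.aeval (definingPoint α β γ k) :
      MvPolynomial (Fin 2) (ZMod 2) →ₐ[ZMod 2] F).range =
      (![1, 2, 4 * r, 4 * r, 4 * r, 4 * r, 4 * r, 4 * r, 4 * r, 4, 4 * r] : Fin 11 → ℕ) k := by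
  have h16 : 16 ≤ 2 ^ (4 * r) := by
    have := fifteen_le_two_pow_sub_one hr
    omega
  have hF' : ∀ z : F, z ^ 2 ^ (4 * r) = z := fun z => by rw [← hF]; exact FiniteField.pow_card z
  have hα3 : IsPrimitiveRoot (α ^ 3) m := hα.pow (by omega) rfl
  have hinj : ∀ {e d : ℕ}, 3 * m ∣ 2 ^ e - 1 ∧ 2 ^ e - 1 ∣ 2 ^ d - 1 → d = 4 * r → e = d := by
    rintro e d ⟨h1, h2⟩ rfl
    have h := Nat.dvd_antisymm h2 (hm ▸ h1)
    have he : 0 < 2 ^ e := by positivity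
    exact Nat.pow_right_injective le_rfl (by show 2 ^ e = 2 ^ (4 * r); omega)
  -- For order `m` one has `2 ^ e - 1 = m c` with `c ∣ 3`. If `c = 1`, then `2 ^ (4r) = 3 · 2 ^ e -
  -- 2`, impossible modulo `4` for `e ≥ 2` and by size for `e ≤ 1`.
  have hinj3 : ∀ {e d : ℕ}, m ∣ 2 ^ e - 1 ∧ 2 ^ e - 1 ∣ 2 ^ d - 1 → d = 4 * r → e = d := by
    rintro e d ⟨h1, h2⟩ rfl
    obtain ⟨c, hc⟩ := h1
    have he : 0 < 2 ^ e := by positivity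
    have hm0 : 0 < m := by omega
    have hc3 : c ∣ 3 := by
      rw [hm, hc, mul_comm 3 m] at h2
      exact Nat.dvd_of_mul_dvd_mul_left hm0 h2
    rcases (Nat.dvd_prime Nat.prime_three).mp hc3 with rfl | rfl
    · exfalso
      have h4 : 2 ^ (4 * r) = 4 * 2 ^ (4 * r - 2) := by
        rw [show 4 * r = 4 * r - 2 + 2 by omega, pow_add]; simp [mul_comm]
      obtain he | he | ⟨f, rfl⟩ : e = 0 ∨ e = 1 ∨ ∃ f, e = f + 2 := by
        rcases e with _ | _ | f
        · simp
        · simp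
        · exact .inr (.inr ⟨f, rfl⟩)
      · subst he; omega
      · subst he; omega
      · rw [pow_add] at hc he; omega
    · exact Nat.pow_right_injective le_rfl (by show 2 ^ e = 2 ^ (4 * r); omega)
  have hβ16 : β ^ 2 ^ 4 = β := by
    rw [show 2 ^ 4 = 5 * 3 + 1 by norm_num, pow_succ, pow_mul, hβ.pow_eq_one, one_pow, one_mul]
  have hγ4 : γ ^ 2 ^ 2 = γ := by
    rw [show 2 ^ 2 = 3 + 1 by norm_num, pow_succ, hγ.pow_eq_one, one_mul]
  have hm0 : 0 < 3 * m := by omega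
  have hm0' : 0 < m := by omega
  -- This bound turns the degree computation for the points with fixed small `d` into a finite
  -- check.
  have hle : ∀ {l e d : ℕ}, l ∣ 2 ^ e - 1 ∧ 2 ^ e - 1 ∣ 2 ^ d - 1 → 0 < d → e ≤ d := by
    rintro l e d ⟨-, h2⟩ hd
    have h1 : 2 ^ 1 ≤ 2 ^ d := Nat.pow_le_pow_right (by norm_num) hd
    have h3 := Nat.le_of_dvd (by omega) h2
    exact (Nat.pow_le_pow_iff_right (by norm_num : 1 < 2)).mp (by omega)
  have hdvd := fun (P : Fin 2 → F) (i : Fin 2) (l : ℕ) (hi : IsPrimitiveRoot (P i) l)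
    (hl : 0 < l) => dvd_two_pow_finrank_range_aeval (P := P) (d := 4 * r) (fun j => hF' _) i hi hl
  fin_cases k
  · have h := dvd_two_pow_finrank_range_aeval (P := ![(1 : F), 1]) (d := 1)
      (Fin.forall_fin_two.mpr ⟨one_pow _, one_pow _⟩) 0 (m := 1) IsPrimitiveRoot.one one_pos
    exact (by decide : ∀ e ≤ 1, 1 ∣ 2 ^ e - 1 ∧ 2 ^ e - 1 ∣ 2 ^ 1 - 1 → e = 1) _
      (hle h (by norm_num)) h
  · have h := dvd_two_pow_finrank_range_aeval (P := ![1, γ]) (d := 2)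
      (Fin.forall_fin_two.mpr ⟨one_pow _, hγ4⟩) 1 (m := 3) hγ (by norm_num)
    exact (by decide : ∀ e ≤ 2, 3 ∣ 2 ^ e - 1 ∧ 2 ^ e - 1 ∣ 2 ^ 2 - 1 → e = 2) _
      (hle h (by norm_num)) h
  · exact hinj3 (hdvd ![1, α ^ 3] 1 m hα3 hm0') rfl
  · exact hinj (hdvd ![1, α] 1 _ hα hm0) rfl
  · exact hinj3 (hdvd ![α ^ 3, 1] 0 m hα3 hm0') rfl
  · exact hinj (hdvd ![α, 1] 0 _ hα hm0) rfl
  · exact hinj (hdvd ![α, α] 0 _ hα hm0) rfl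
  · exact hinj3 (hdvd ![α ^ 3, (α ^ 3)⁻¹] 0 m hα3 hm0') rfl
  · exact hinj (hdvd ![α, α⁻¹] 0 _ hα hm0) rfl
  · have hβ' : (β ^ 2) ^ 2 ^ 4 = β ^ 2 := by rw [pow_right_comm, hβ16]
    have h := dvd_two_pow_finrank_range_aeval (P := ![β, β ^ 2]) (d := 4)
      (Fin.forall_fin_two.mpr ⟨hβ16, hβ'⟩) 0 (m := 5) hβ (by norm_num)
    exact (by decide : ∀ e ≤ 4, 5 ∣ 2 ^ e - 1 ∧ 2 ^ e - 1 ∣ 2 ^ 4 - 1 → e = 4) _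
      (hle h (by norm_num)) h
  · exact hinj (hdvd ![α, α ^ 2] 0 _ hα hm0) rfl

lemma finrank_cyclicCode2D_definingSet [Fintype F] {r : ℕ} (hr : 1 ≤ r)
    (hF : Fintype.card F = 2 ^ (4 * r)) {α β γ : F}
    (hα : IsPrimitiveRoot α (2 ^ (4 * r) - 1)) (hβ : IsPrimitiveRoot β 5)
    (hγ : IsPrimitiveRoot γ 3) :
    Module.finrank (ZMod 2) (cyclicCode2D (2 ^ (4 * r) - 1) (definingSet α β γ)) =
      (2 ^ (4 * r) - 1) ^ 2 - 32 * r - 7 := by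
  obtain ⟨l, hl⟩ := fifteen_dvd_two_pow_sub_one r
  have hn := fifteen_le_two_pow_sub_one hr
  have hm : 2 ^ (4 * r) - 1 = 3 * (5 * l) := by rw [hl]; ring
  have hα' : IsPrimitiveRoot α (3 * (5 * l)) := hm ▸ hα
  have hker : Function.Injective fun k => RingHom.ker (MvPolynomial.aeval (definingPoint α β γ k) :
      MvPolynomial (Fin 2) (ZMod 2) →ₐ[ZMod 2] F) := by
    intro j k hjk
    have h := congrArg (pointIndex (5 * l)) hjk
    simp only [pointIndex_ker_aeval (dvd_mul_right 5 l) (by omega) hα' hβ hγ] at h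
    exact Fin.ext h
  have h := finrank_cyclicCode2D_add_sum (n := 2 ^ (4 * r) - 1) (by omega) (definingPoint α β γ)
    (fun k i => pow_eq_one_of_mem_definingSet (fifteen_dvd_two_pow_sub_one r) hα.pow_eq_one
      hβ.pow_eq_one hγ.pow_eq_one (range_definingPoint α β γ ▸ Set.mem_range_self k) i) hker
  rw [Finset.sum_congr rfl fun k _ => finrank_range_aeval_definingPoint hr hm hF hα' hβ hγ k,
    range_definingPoint] at h
  -- The relation is additive, dimension plus `32r + 7` equals `n²`, so the truncated subtractions
  -- in the goal lose nothing.
  simp [Fin.sum_univ_succ] at h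
  omega

end

end

theorem theorem5 {F : Type*} [Field F] [Fintype F] [Algebra (ZMod 2) F]
    (r : ℕ) (hr : 1 ≤ r) (hF : Fintype.card F = 2 ^ (4 * r))
    (α β γ : F)
    (hα : IsPrimitiveRoot α (2 ^ (4 * r) - 1))
    (hβ : IsPrimitiveRoot β 5)
    (hγ : IsPrimitiveRoot γ 3)
    (ψ : QVec (Fin (2 ^ (4 * r) - 1) × Fin (2 ^ (4 * r) - 1)))
    (hψ : IsGraphState (periodicLattice (2 ^ (4 * r) - 1) (2 ^ (4 * r) - 1)) ψ) :
    IsPureQECC ((2 ^ (4 * r) - 1) ^ 2) ((2 ^ (4 * r) - 1) ^ 2 - 32 * r - 7) 5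
      (cwsCode ψ (cyclicCode2D (2 ^ (4 * r) - 1) (definingSet α β γ))) where
  card_qubits := by rw [Fintype.card_prod, Fintype.card_fin, sq]
  finrank_eq := by
    rw [hψ.finrank_cwsCode, finrank_cyclicCode2D_definingSet hr hF hα hβ hγ]
  pure _ hpos hlt _ hφ :=
    hψ.braket_cwsCode_eq_zero
      (graphSyndrome_notMem_cyclicCode2D (fifteen_le_two_pow_sub_one hr)
        (fifteen_dvd_two_pow_sub_one r) hα hβ hγ hpos hlt) hφ hφ
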